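/- Work over $\mathbb{C}$. Let $n\in\{0,2\}$, let $\mathbb{F}_n$ be the Hirzebruch surface with fibre class $f$ and minimal section $e$ ($e^2=-n$, $e\cdot f=1$, $f^2=0$), and let $\varphi:\mathbb{F}_n\hookrightarrow\mathbb{P}^5$ be a closed embedding whose image $R$ is a quartic scroll, i.e. the hyperplane class $H$ of $\varphi$ satisfies $H\cdot f=1$ (the fibres are embedded as lines) and $H^2=4$. A cubic Segre product is the image $S\subset\mathbb{P}^5$ of an embedding of $\mathbb{P}^1\times\mathbb{P}^2$ by the complete linear system $|\mathcal{O}_{\mathbb{P}^1\times\mathbb{P}^2}(1,1)|$ (in some choice of homogeneous coordinates on $\mathbb{P}^5$). (1) If $n=0$, there is a unique cubic Segre product $S\cong\mathbb{P}^1\times\mathbb{P}^2$ in $\mathbb{P}^5$ that contains $R$ as an element of the linear system $|\mathcal{O}_{\mathbb{P}^1\times\mathbb{P}^2}(0,2)|$. (2) If $n=2$, there is a unique cone $T\subset\mathbb{P}^5$ that contains $R$, has vertex $\varphi(e)$, which is a line, and whose base is a rational normal cubic curve spanning a three-space complementary to the line $\varphi(e)$. -/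

import Mathlib

/-- Complex projective five-space. -/
abbrev P5 : Type := Projectivization ℂ (Fin 6 → ℂ)

/-- `v` is a vector of homogeneous coordinates of the point `p`. -/
def HasCoords (p : P5) (v : Fin 6 → ℂ) : Prop :=
  ∃ hv : v ≠ 0, p = Projectivization.mk ℂ v hv

/-! ### Hirzebruch surfaces

`𝔽 n` is the toric surface with homogeneous (Cox) coordinates `(s, t; v, u)`, where `(s, t) ≠ 0`
and `(v, u) ≠ 0`, modulo `(s, t; v, u) ∼ (a s, a t; b v, b aⁿ u)`. The projection to `[s : t]` is
the `ℙ¹`-bundle `ℙ(𝒪 ⊕ 𝒪(n)) → ℙ¹`, with fibre `f`, and the minimal section `e` is `v = 0`.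
The class `x e + y f` of the Picard group is written `(x, y) : ℤ × ℤ`. -/

/-- The coordinates: `inl 0 = s`, `inl 1 = t`, `inr 0 = v`, `inr 1 = u`. -/
abbrev CoxIndex : Type := Fin 2 ⊕ Fin 2

/-- Coordinate vectors of points of `𝔽 n`. -/
def CoxPoint : Type :=
  {p : CoxIndex → ℂ // (∃ i, p (Sum.inl i) ≠ 0) ∧ (∃ i, p (Sum.inr i) ≠ 0)}

/-- Two coordinate vectors define the same point of `𝔽 n`. -/
def CoxPoint.Equiv (n : ℕ) (p q : CoxPoint) : Prop :=
  ∃ a b : ℂˣ, (∀ i, q.1 (Sum.inl i) = a * p.1 (Sum.inl i)) ∧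
    q.1 (Sum.inr 0) = b * p.1 (Sum.inr 0) ∧
    q.1 (Sum.inr 1) = b * (a : ℂ) ^ n * p.1 (Sum.inr 1)

/-- Equality of points of `𝔽 n` as an equivalence relation on coordinate vectors. -/
def coxSetoid (n : ℕ) : Setoid CoxPoint where
  r := CoxPoint.Equiv n
  iseqv :=
    { refl := fun p => ⟨1, 1, by simp⟩
      symm := by
        rintro p q ⟨a, b, h1, h2, h3⟩
        refine ⟨a⁻¹, b⁻¹, fun i => ?_, ?_, ?_⟩
        · simp [h1]
        · simp [h2]
        · rw [h3]
          have ha : (a : ℂ) ^ n ≠ 0 := pow_ne_zero n a.ne_zero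
          have hb := b.ne_zero
          simp only [Units.val_inv_eq_inv_val, inv_pow]
          field_simp
      trans := by
        rintro p q r ⟨a, b, h1, h2, h3⟩ ⟨c, d, k1, k2, k3⟩
        refine ⟨c * a, d * b, fun i => ?_, ?_, ?_⟩
        · rw [k1, h1]; push_cast; ring
        · rw [k2, h2]; push_cast; ring
        · rw [k3, h3]; push_cast; ring }

/-- The (closed points of the) Hirzebruch surface `𝔽 n` over `ℂ`. -/
def Hirzebruch (n : ℕ) : Type := Quotient (coxSetoid n)

/-- The point of `𝔽 n` with the given coordinates. -/
def Hirzebruch.mk (n : ℕ) (p : CoxPoint) : Hirzebruch n := Quotient.mk (coxSetoid n) p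

/-- The minimal section `e` of `𝔽 n`. -/
def minimalSection (n : ℕ) : Set (Hirzebruch n) :=
  {x | ∃ p : CoxPoint, p.1 (Sum.inr 0) = 0 ∧ x = Hirzebruch.mk n p}

/-- The class in `Pic (𝔽 n)` of the divisor cut out by each coordinate:
`s, t` have class `f`, `v` has class `e`, and `u` has class `e + n f`. -/
def coxWeight (n : ℕ) : CoxIndex → ℤ × ℤ :=
  Sum.elim (fun _ => (0, 1)) ![(1, 0), (1, (n : ℤ))]

/-- The intersection form on `Pic (𝔽 n)`: `e² = -n`, `e·f = 1`, `f² = 0`. -/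
def interNumber (n : ℕ) (C D : ℤ × ℤ) : ℤ :=
  -(n : ℤ) * C.1 * D.1 + C.1 * D.2 + C.2 * D.1

/-- A closed embedding of `𝔽 n` in projective five-space: a map given by six sections of one line
bundle without common zeros (sections of a line bundle on `𝔽 n` are the homogeneous polynomials of
that class in the Cox coordinates), injective on points and on tangent vectors. -/
structure HirzebruchEmbedding (n : ℕ) where
  /-- The underlying map on points. -/
  toFun : Hirzebruch n → P5
  /-- The class `H` of the pullback of `𝒪(1)`. -/
  cls : ℤ × ℤ
  /-- The pullbacks of the six homogeneous coordinates. -/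
  coord : Fin 6 → MvPolynomial CoxIndex ℂ
  homogeneous : ∀ i, (coord i).IsWeightedHomogeneous (coxWeight n) cls
  hasCoords : ∀ p : CoxPoint,
    HasCoords (toFun (Hirzebruch.mk n p)) (fun i => MvPolynomial.eval p.1 (coord i))
  injective : Function.Injective toFun
  /-- The differential of the map is injective. Upstairs, on `ℂ⁴ → ℂ⁶`, this says that the Jacobian
  matrix has rank `3`: two for the tangent plane of `𝔽 n`, one for the scaling of `ℂ⁶`. -/
  immersive : ∀ p : CoxPoint,
    (Matrix.of fun i j => MvPolynomial.eval p.1 (MvPolynomial.pderiv j (coord i))).rank = 3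

/-- The embedded surface. -/
def HirzebruchEmbedding.surface {n : ℕ} (φ : HirzebruchEmbedding n) : Set P5 :=
  Set.range φ.toFun

/-- The embedded surface is a quartic scroll: the fibres of `𝔽 n → ℙ¹` are embedded as lines,
`H·f = 1`, and the degree `H²` is `4`. -/
def HirzebruchEmbedding.IsQuarticScroll {n : ℕ} (φ : HirzebruchEmbedding n) : Prop :=
  interNumber n φ.cls (0, 1) = 1 ∧ interNumber n φ.cls φ.cls = 4

/-! ### Cubic Segre products -/

/-- The vector `(zᵢ xⱼ)` of values of the sections of `𝒪(1,1)` on `ℙ¹ × ℙ²`. -/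
def segreVector (z : Fin 2 → ℂ) (x : Fin 3 → ℂ) : Fin 2 × Fin 3 → ℂ :=
  fun k => z k.1 * x k.2

/-- The image of the Segre embedding `ℙ¹ × ℙ² → ℙ⁵`, `([z], [x]) ↦ [g (zᵢ xⱼ)]`, where the linear
isomorphism `g` is the choice of homogeneous coordinates on `ℙ⁵`. -/
def segreProduct (g : (Fin 2 × Fin 3 → ℂ) ≃ₗ[ℂ] (Fin 6 → ℂ)) : Set P5 :=
  {p | ∃ z x, z ≠ 0 ∧ x ≠ 0 ∧ HasCoords p (g (segreVector z x))}

/-- Bidegrees of the coordinates of `ℙ¹ × ℙ²`. -/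
def segreWeight : Fin 2 ⊕ Fin 3 → ℕ × ℕ :=
  Sum.elim (fun _ => (1, 0)) (fun _ => (0, 1))

/-- `R`, as a reduced divisor of the Segre product embedded by `g`, is an element of the linear
system `|𝒪(a,b)|`: it is the zero divisor of a form of bidegree `(a,b)`. -/
def IsSegreDivisor (g : (Fin 2 × Fin 3 → ℂ) ≃ₗ[ℂ] (Fin 6 → ℂ)) (a b : ℕ) (R : Set P5) : Prop :=
  ∃ F : MvPolynomial (Fin 2 ⊕ Fin 3) ℂ, F.IsWeightedHomogeneous segreWeight (a, b) ∧
    Squarefree F ∧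
    R = {p | ∃ z x, z ≠ 0 ∧ x ≠ 0 ∧ MvPolynomial.eval (Sum.elim z x) F = 0 ∧
      HasCoords p (g (segreVector z x))}

/-- `S` is a cubic Segre product in `ℙ⁵` that contains `R` as an element of `|𝒪(a,b)|`. -/
def IsCubicSegreProductContaining (a b : ℕ) (R S : Set P5) : Prop :=
  ∃ g : (Fin 2 × Fin 3 → ℂ) ≃ₗ[ℂ] (Fin 6 → ℂ), S = segreProduct g ∧ IsSegreDivisor g a b R

/-! ### Cones over rational normal cubics -/

/-- The points of the projective subspace of `ℙ⁵` defined by a linear subspace. -/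
def linearPoints (W : Submodule ℂ (Fin 6 → ℂ)) : Set P5 := {p | p.submodule ≤ W}

/-- The rational normal cubic `{[A (s³, s²t, st², t³)]}` in the three-space defined by the range of
`A` (for injective `A`). -/
def rationalNormalCubic (A : (Fin 4 → ℂ) →ₗ[ℂ] (Fin 6 → ℂ)) : Set P5 :=
  {p | ∃ s t : ℂ, (s ≠ 0 ∨ t ≠ 0) ∧ HasCoords p (A ![s ^ 3, s ^ 2 * t, s * t ^ 2, t ^ 3])}

/-- The union of the lines joining a point of `E` to a point of `C`, for disjoint `E` and `C`. -/
def projectiveJoin (E C : Set P5) : Set P5 :=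
  {p | ∃ x ∈ E, ∃ y ∈ C, p.submodule ≤ x.submodule ⊔ y.submodule}

/-- `T` is a cone with vertex `E`, where `E` is a line, over a rational normal cubic spanning a
three-space complementary to `E`. -/
def IsConeOverRationalNormalCubic (E T : Set P5) : Prop :=
  ∃ (W : Submodule ℂ (Fin 6 → ℂ)) (A : (Fin 4 → ℂ) →ₗ[ℂ] (Fin 6 → ℂ)),
    E = linearPoints W ∧ Function.Injective A ∧ IsCompl W (LinearMap.range A) ∧
    T = projectiveJoin E (rationalNormalCubic A)

/-! ### Homogeneous coordinates -/

/-! Write H = x e + y f. The conditions H·f = 1 and H² = 4 force H = e + 2f on 𝔽 0 and H = e + 3f on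
𝔽 2. Each class has exactly six monomials, so the embedding is the standard monomial map followed by
a 6 × 6 matrix. The secants and tangents of the standard scroll fill ℂ⁶, and an embedding kills no
nonzero secant or tangent vector, so the matrix is invertible
(`HirzebruchEmbedding.mulVec_injective`) and R is standard up to a change of coordinates.

For n = 0, R is ℙ¹ × conic in ℙ¹ × ℙ², which gives existence. A second Segre product differs from
the first by a linear automorphism of ℂ² ⊗ ℂ³ under which the fibres ℙ¹ × {x} lying in R correspond
to the fibres over the conic, because R contains no other lines. Comparing four conic points in
general position forces the automorphism to be a product A ⊗ B (`exists_segre_factors`), and a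
product preserves the Segre variety.

For n = 2, R joins corresponding points of the line φ(e) and a twisted cubic in a complementary
three-space, so it lies in the cone over that cubic. If a second cone with the same vertex contains
R, projection from the vertex sends the first cubic into the second. The map is onto, since an
osculating plane meets the second cubic in one point only and its pullback vanishes somewhere on the
first (`exists_cubic_preimage`). So the cones coincide. -/

lemma HasCoords.ne_zero {p : P5} {v : Fin 6 → ℂ} (h : HasCoords p v) : v ≠ 0 := h.1

lemma hasCoords_mk {v : Fin 6 → ℂ} (hv : v ≠ 0) : HasCoords (Projectivization.mk ℂ v hv) v :=
  ⟨hv, rfl⟩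

lemma exists_hasCoords (p : P5) : ∃ v, HasCoords p v :=
  ⟨p.rep, p.rep_nonzero, p.mk_rep.symm⟩

lemma HasCoords.exists_smul_eq {p : P5} {v w : Fin 6 → ℂ} (hv : HasCoords p v)
    (hw : HasCoords p w) : ∃ c : ℂ, c ≠ 0 ∧ w = c • v := by
  obtain ⟨hv0, rfl⟩ := hv
  obtain ⟨hw0, h⟩ := hw
  obtain ⟨c, hc⟩ := (Projectivization.mk_eq_mk_iff' ℂ _ _ hw0 hv0).1 h.symm
  refine ⟨c, ?_, hc.symm⟩
  rintro rfl
  exact hw0 (by simp [← hc])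

lemma HasCoords.smul {p : P5} {v : Fin 6 → ℂ} (hv : HasCoords p v) {c : ℂ} (hc : c ≠ 0) :
    HasCoords p (c • v) := by
  obtain ⟨hv0, rfl⟩ := hv
  refine ⟨smul_ne_zero hc hv0, ?_⟩
  exact (Projectivization.mk_eq_mk_iff' ℂ _ _ _ _).2 ⟨c⁻¹, by simp [hc]⟩

lemma HasCoords.eq {p q : P5} {v : Fin 6 → ℂ} (hp : HasCoords p v) (hq : HasCoords q v) :
    p = q := by
  obtain ⟨_, rfl⟩ := hp
  obtain ⟨_, rfl⟩ := hq
  rfl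

lemma HasCoords.submodule_eq {p : P5} {v : Fin 6 → ℂ} (h : HasCoords p v) :
    p.submodule = Submodule.span ℂ {v} := by
  obtain ⟨_, rfl⟩ := h
  exact Projectivization.submodule_mk _ _

/-! ### Points and tangent vectors of the embedded surface -/

open MvPolynomial in
/-- The values at `p` of a family of polynomials in the Cox coordinates. -/
noncomputable def coxValues {K : Type*} (f : K → MvPolynomial CoxIndex ℂ) (p : CoxIndex → ℂ) :
    K → ℂ :=
  fun k => eval p (f k)

open MvPolynomial in
/-- The derivatives at `p` in the direction `w` of a family of polynomials in the Cox
coordinates. -/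
noncomputable def coxDeriv {K : Type*} (f : K → MvPolynomial CoxIndex ℂ) (p w : CoxIndex → ℂ) :
    K → ℂ :=
  fun k => ∑ j, eval p (pderiv j (f k)) * w j

/-- The coordinate vector `(s, t; v, u)` with `z = (s, t)` and `w = (v, u)`. -/
def CoxPoint.of (z w : Fin 2 → ℂ) (hz : z ≠ 0) (hw : w ≠ 0) : CoxPoint :=
  ⟨Sum.elim z w, by simpa using Function.ne_iff.1 hz, by simpa using Function.ne_iff.1 hw⟩

lemma CoxPoint.exists_of (p : CoxPoint) : ∃ z w hz hw, p = CoxPoint.of z w hz hw := by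
  refine ⟨fun i => p.1 (Sum.inl i), fun i => p.1 (Sum.inr i), ?_, ?_, ?_⟩
  · exact Function.ne_iff.2 p.2.1
  · exact Function.ne_iff.2 p.2.2
  · apply Subtype.ext
    funext i
    cases i <;> rfl

section Coordinates

variable {n : ℕ} {φ : HirzebruchEmbedding n} {K : Type*} [Fintype K]
  {f : K → MvPolynomial CoxIndex ℂ} {m : Matrix (Fin 6) K ℂ}

lemma HirzebruchEmbedding.eval_coord (hm : ∀ i, φ.coord i = ∑ k, m i k • f k)
    (p : CoxIndex → ℂ) :
    (fun i => MvPolynomial.eval p (φ.coord i)) = m.mulVec (coxValues f p) := by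
  funext i
  simp [hm, Matrix.mulVec, dotProduct, coxValues]

lemma HirzebruchEmbedding.jacobian_mulVec (hm : ∀ i, φ.coord i = ∑ k, m i k • f k)
    (p w : CoxIndex → ℂ) :
    (Matrix.of fun i j => MvPolynomial.eval p (MvPolynomial.pderiv j (φ.coord i))).mulVec w =
      m.mulVec (coxDeriv f p w) := by
  funext i
  simp only [hm, Matrix.mulVec, dotProduct, coxDeriv, Matrix.of_apply, map_sum, Finset.sum_mul,
    Finset.mul_sum, Derivation.map_smul, MvPolynomial.smul_eval]
  rw [Finset.sum_comm]
  simp only [mul_assoc]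

lemma HirzebruchEmbedding.hasCoords_mulVec (hm : ∀ i, φ.coord i = ∑ k, m i k • f k)
    (p : CoxPoint) : HasCoords (φ.toFun (Hirzebruch.mk n p)) (m.mulVec (coxValues f p.1)) := by
  rw [← eval_coord hm]
  exact φ.hasCoords p

lemma HirzebruchEmbedding.mem_surface_iff (hm : ∀ i, φ.coord i = ∑ k, m i k • f k) (x : P5) :
    x ∈ φ.surface ↔ ∃ z w, z ≠ 0 ∧ w ≠ 0 ∧ HasCoords x (m.mulVec (coxValues f (Sum.elim z w))) := by
  constructor
  · rintro ⟨q, rfl⟩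
    obtain ⟨p, rfl⟩ := Quotient.exists_rep q
    obtain ⟨z, w, hz, hw, rfl⟩ := p.exists_of
    exact ⟨z, w, hz, hw, φ.hasCoords_mulVec hm (CoxPoint.of z w hz hw)⟩
  · rintro ⟨z, w, hz, hw, h⟩
    exact ⟨Hirzebruch.mk n (CoxPoint.of z w hz hw), (φ.hasCoords_mulVec hm _).eq h⟩

/-- An embedding separates points, so no vector on a secant line is in the kernel. -/
lemma HirzebruchEmbedding.secant_eq_zero (hm : ∀ i, φ.coord i = ∑ k, m i k • f k)
    (hf : ∀ p q, CoxPoint.Equiv n p q → ∃ c : ℂ, coxValues f q.1 = c • coxValues f p.1)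
    (hf0 : ∀ z : Fin 2 → ℂ, coxValues f (Sum.elim z 0) = 0)
    {z₁ w₁ z₂ w₂ : Fin 2 → ℂ} (hz₁ : z₁ ≠ 0) (hz₂ : z₂ ≠ 0)
    (h : m.mulVec (coxValues f (Sum.elim z₁ w₁) + coxValues f (Sum.elim z₂ w₂)) = 0) :
    coxValues f (Sum.elim z₁ w₁) + coxValues f (Sum.elim z₂ w₂) = 0 := by
  have hne : ∀ z w : Fin 2 → ℂ, z ≠ 0 → w ≠ 0 → m.mulVec (coxValues f (Sum.elim z w)) ≠ 0 :=
    fun z w hz hw => (φ.hasCoords_mulVec hm (CoxPoint.of z w hz hw)).ne_zero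
  -- A zero fibre coordinate gives no point of the surface, only the zero vector. Then at most one
  -- summand is left, and its image is a coordinate vector, hence nonzero.
  by_cases hw₁ : w₁ = 0
  · subst hw₁
    by_cases hw₂ : w₂ = 0
    · subst hw₂
      simp [hf0]
    · rw [hf0, zero_add] at h
      exact absurd h (hne _ _ hz₂ hw₂)
  by_cases hw₂ : w₂ = 0
  · subst hw₂
    rw [hf0, add_zero] at h
    exact absurd h (hne _ _ hz₁ hw₁)
  set p := CoxPoint.of z₁ w₁ hz₁ hw₁
  set q := CoxPoint.of z₂ w₂ hz₂ hw₂
  have hp := φ.hasCoords_mulVec hm p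
  have hq := φ.hasCoords_mulVec hm q
  -- Opposite images are the same projective point, so injectivity identifies `p` and `q`, and the
  -- sum is a multiple of a single vector whose image is nonzero.
  have hpq : m.mulVec (coxValues f q.1) = (-1 : ℂ) • m.mulVec (coxValues f p.1) := by
    rw [Matrix.mulVec_add] at h
    rw [neg_one_smul]
    exact eq_neg_of_add_eq_zero_right h
  have e : φ.toFun (Hirzebruch.mk n p) = φ.toFun (Hirzebruch.mk n q) :=
    (hp.smul (neg_ne_zero.2 one_ne_zero)).eq (hpq ▸ hq)
  obtain ⟨c, hc⟩ := hf p q (Quotient.exact (φ.injective e))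
  have hs : coxValues f (Sum.elim z₁ w₁) + coxValues f (Sum.elim z₂ w₂)
      = (1 + c) • coxValues f p.1 := by
    rw [add_smul, one_smul, ← hc]
    rfl
  rw [hs, Matrix.mulVec_smul, smul_eq_zero, or_iff_left hp.ne_zero] at h
  rw [hs, h, zero_smul]

/-- An embedding separates tangent vectors, so no vector of an embedded tangent plane is in the
kernel. -/
lemma HirzebruchEmbedding.tangent_eq_zero (hm : ∀ i, φ.coord i = ∑ k, m i k • f k)
    (hE : ∀ p : CoxPoint, ∃ E : CoxIndex → ℂ, E ≠ 0 ∧ coxDeriv f p.1 E = 0)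
    {z w : Fin 2 → ℂ} (hz : z ≠ 0) (hw : w ≠ 0) {a : CoxIndex → ℂ}
    (h : m.mulVec (coxDeriv f (Sum.elim z w) a) = 0) : coxDeriv f (Sum.elim z w) a = 0 := by
  set p := CoxPoint.of z w hz hw
  set J : Matrix (Fin 6) CoxIndex ℂ :=
    Matrix.of fun i j => MvPolynomial.eval p.1 (MvPolynomial.pderiv j (φ.coord i)) with hJ
  have hr : Module.finrank ℂ (LinearMap.range J.mulVecLin) = 3 := φ.immersive p
  have hk : Module.finrank ℂ (LinearMap.ker J.mulVecLin) = 1 := by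
    have := J.mulVecLin.finrank_range_add_finrank_ker
    simp only [Module.finrank_fintype_fun_eq_card, Fintype.card_sum, Fintype.card_fin] at this
    omega
  have hmem : ∀ b, J.mulVec b = m.mulVec (coxDeriv f p.1 b) := φ.jacobian_mulVec hm p.1
  -- `E` is tangent to a one-parameter group of rescalings that fixes all values. It spans the
  -- one-dimensional kernel of the Jacobian, so `a` is a multiple of it.
  obtain ⟨E, hE0, hE⟩ := hE p
  have hEk : E ∈ LinearMap.ker J.mulVecLin := by
    simp [hmem, hE]
  have hak : a ∈ LinearMap.ker J.mulVecLin := by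
    rw [LinearMap.mem_ker, Matrix.mulVecLin_apply, hmem]
    exact h
  obtain ⟨c, hc⟩ := (finrank_eq_one_iff_of_nonzero' (⟨E, hEk⟩ : LinearMap.ker J.mulVecLin)
    (by simpa using hE0)).1 hk ⟨a, hak⟩
  have hca : a = c • E := (congrArg Subtype.val hc).symm
  have hlin : coxDeriv f p.1 a = c • coxDeriv f p.1 E := by
    funext k
    simp only [coxDeriv, hca, Pi.smul_apply, smul_eq_mul, Finset.mul_sum]
    exact Finset.sum_congr rfl fun j _ => by ring
  change coxDeriv f p.1 a = 0
  rw [hlin, hE, smul_zero]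

end Coordinates

/-! ### Binary quadrics and cubics -/

/-- The point of the conic with parameter `z`. -/
def conicVector (z : Fin 2 → ℂ) : Fin 3 → ℂ := ![z 0 ^ 2, z 0 * z 1, z 1 ^ 2]

/-- The polarisation of `conicVector`. -/
def conicPolar (z r : Fin 2 → ℂ) : Fin 3 → ℂ :=
  ![2 * z 0 * r 0, z 0 * r 1 + z 1 * r 0, 2 * z 1 * r 1]

/-- The point of the twisted cubic with parameter `z`. -/
def cubicVector (z : Fin 2 → ℂ) : Fin 4 → ℂ := ![z 0 ^ 3, z 0 ^ 2 * z 1, z 0 * z 1 ^ 2, z 1 ^ 3]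

/-- The derivative of `cubicVector` at `z` in the direction `r`. -/
def cubicDeriv (z r : Fin 2 → ℂ) : Fin 4 → ℂ :=
  ![3 * z 0 ^ 2 * r 0, 2 * z 0 * z 1 * r 0 + z 0 ^ 2 * r 1,
    z 1 ^ 2 * r 0 + 2 * z 0 * z 1 * r 1, 3 * z 1 ^ 2 * r 1]

/-- The determinant of two vectors of the plane. -/
def wedge (p r : Fin 2 → ℂ) : ℂ := p 0 * r 1 - p 1 * r 0

/-- The linear form in `a` that vanishes exactly when the product of the linear forms with roots `p` and `r` is
apolar to `a`. -/
def apolar (p r : Fin 2 → ℂ) (a : Fin 3 → ℂ) : ℂ :=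
  p 1 * r 1 * a 0 - (p 0 * r 1 + p 1 * r 0) * a 1 + p 0 * r 0 * a 2

lemma fin_two_ne_zero {p : Fin 2 → ℂ} (hp : p ≠ 0) : p 0 ≠ 0 ∨ p 1 ≠ 0 := by
  by_contra! h
  exact hp (funext fun i => by fin_cases i <;> simp [h.1, h.2])

lemma exists_eq_mul_of_mul_eq {p : Fin 2 → ℂ} (hp : p ≠ 0) {x y : ℂ} (h : x * p 1 = y * p 0) :
    ∃ c, x = c * p 0 ∧ y = c * p 1 := by
  rcases fin_two_ne_zero hp with h0 | h1
  · refine ⟨x / p 0, by field_simp, ?_⟩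
    field_simp
    exact h.symm
  · refine ⟨y / p 1, ?_, by field_simp⟩
    field_simp
    exact h

lemma exists_smul_of_wedge_eq_zero {p r : Fin 2 → ℂ} (hp : p ≠ 0) (h : wedge p r = 0) :
    ∃ c : ℂ, r = c • p := by
  obtain ⟨c, h0, h1⟩ := exists_eq_mul_of_mul_eq hp (x := r 0) (y := r 1)
    (by rw [wedge] at h; linear_combination -h)
  exact ⟨c, funext fun i => by fin_cases i <;> simp [h0, h1]⟩

lemma exists_wedge_ne_zero {p : Fin 2 → ℂ} (hp : p ≠ 0) : ∃ r, wedge p r ≠ 0 := by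
  rcases fin_two_ne_zero hp with h | h
  · exact ⟨![0, 1], by simpa [wedge] using h⟩
  · exact ⟨![1, 0], by simpa [wedge] using h⟩

lemma ne_zero_of_wedge_ne_zero {p r : Fin 2 → ℂ} (h : wedge p r ≠ 0) : p ≠ 0 ∧ r ≠ 0 := by
  constructor <;> rintro rfl <;> simp [wedge] at h

lemma eq_zero_of_wedge_ne_zero {p r : Fin 2 → ℂ} (h : wedge p r ≠ 0) {x y : ℂ}
    (h0 : p 0 * x + r 0 * y = 0) (h1 : p 1 * x + r 1 * y = 0) : x = 0 ∧ y = 0 := by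
  constructor
  · refine (mul_eq_zero.1 (?_ : wedge p r * x = 0)).resolve_left h
    rw [wedge]
    linear_combination r 1 * h0 - r 0 * h1
  · refine (mul_eq_zero.1 (?_ : wedge p r * y = 0)).resolve_left h
    rw [wedge]
    linear_combination p 0 * h1 - p 1 * h0

/-- A binary quadratic form splits into linear factors. -/
lemma exists_factors {q : Fin 3 → ℂ} (hq : q ≠ 0) :
    ∃ p r : Fin 2 → ℂ, p ≠ 0 ∧ r ≠ 0 ∧ ∀ a, apolar p r a = q 0 * a 0 + q 1 * a 1 + q 2 * a 2 := by
  suffices h : ∃ p r : Fin 2 → ℂ, p 1 * r 1 = q 0 ∧ -(p 0 * r 1 + p 1 * r 0) = q 1 ∧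
      p 0 * r 0 = q 2 by
    obtain ⟨p, r, h0, h1, h2⟩ := h
    have key : ¬ (q 0 = 0 ∧ q 1 = 0 ∧ q 2 = 0) := fun h =>
      hq (funext fun i => by fin_cases i <;> simp [h.1, h.2.1, h.2.2])
    refine ⟨p, r, ?_, ?_, fun a => ?_⟩
    · rintro rfl
      exact key ⟨by simp [← h0], by simp [← h1], by simp [← h2]⟩
    · rintro rfl
      exact key ⟨by simp [← h0], by simp [← h1], by simp [← h2]⟩
    · rw [apolar, ← h0, ← h1, ← h2]
      ring
  by_cases h0 : q 0 = 0
  -- One root is [1 : 0]; the sign of `-1` makes the product match `q`.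
  · exact ⟨![-1, 0], ![-q 2, q 1], by simp [h0], by simp, by simp⟩
  · obtain ⟨d, hd⟩ := IsAlgClosed.exists_pow_nat_eq (q 1 ^ 2 - 4 * q 0 * q 2) (n := 2) (by norm_num)
    -- The two roots of the quadratic formula, the second scaled by `q 0` to fix the leading
    -- coefficient.
    refine ⟨![(-q 1 + d) / (2 * q 0), 1], ![(-q 1 - d) / 2, q 0], by simp, ?_, ?_⟩
    · simp only [Matrix.cons_val_zero, Matrix.cons_val_one]
      field_simp
      ring
    · simp only [Matrix.cons_val_zero]
      field_simp
      linear_combination -hd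

/-- Two ternary vectors are apolar to a common product of two linear forms. -/
lemma exists_apolar_eq_zero (a b : Fin 3 → ℂ) :
    ∃ p r : Fin 2 → ℂ, p ≠ 0 ∧ r ≠ 0 ∧ apolar p r a = 0 ∧ apolar p r b = 0 := by
  have hker : LinearMap.ker (Matrix.mulVecLin (Matrix.of ![a, b])) ≠ ⊥ :=
    LinearMap.ker_ne_bot_of_finrank_lt (by simp)
  obtain ⟨q, hq, hq0⟩ := (Submodule.ne_bot_iff _).1 hker
  obtain ⟨p, r, hp, hr, h⟩ := exists_factors hq0
  rw [LinearMap.mem_ker, Matrix.mulVecLin_apply] at hq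
  refine ⟨p, r, hp, hr, ?_, ?_⟩
  · rw [h]
    have := congrFun hq 0
    simp only [Matrix.mulVec, dotProduct, Fin.sum_univ_three, Matrix.of_apply,
      Matrix.cons_val_zero, Pi.zero_apply] at this
    linear_combination this
  · rw [h]
    have := congrFun hq 1
    simp only [Matrix.mulVec, dotProduct, Fin.sum_univ_three, Matrix.of_apply,
      Matrix.cons_val_one, Matrix.cons_val_fin_one, Pi.zero_apply] at this
    linear_combination this

/-- Expansion of `a` in the basis of ℂ³ formed by two conic points and the pole of their chord. Each
coefficient is an apolar pairing, so an apolarity condition removes one basis vector. -/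
lemma wedge_sq_smul (p r : Fin 2 → ℂ) (a : Fin 3 → ℂ) :
    wedge p r ^ 2 • a = apolar r r a • conicVector p + apolar p p a • conicVector r
      - apolar p r a • conicPolar p r := by
  funext i
  fin_cases i <;> simp [wedge, apolar, conicVector, conicPolar] <;> ring

lemma exists_secant_conic {p r : Fin 2 → ℂ} (h : wedge p r ≠ 0) {a : Fin 3 → ℂ}
    (ha : apolar p r a = 0) : ∃ x y : ℂ, a = x • conicVector p + y • conicVector r := by
  refine ⟨apolar r r a / wedge p r ^ 2, apolar p p a / wedge p r ^ 2, ?_⟩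
  have := wedge_sq_smul p r a
  rw [ha, zero_smul, sub_zero] at this
  rw [div_eq_inv_mul, div_eq_inv_mul, mul_smul, mul_smul, ← smul_add, ← this, smul_smul,
    inv_mul_cancel₀ (pow_ne_zero 2 h), one_smul]

lemma exists_tangent_conic {p r : Fin 2 → ℂ} (h : wedge p r ≠ 0) {a : Fin 3 → ℂ}
    (ha : apolar p p a = 0) : ∃ x y : ℂ, a = x • conicVector p + y • conicPolar p r := by
  refine ⟨apolar r r a / wedge p r ^ 2, -apolar p r a / wedge p r ^ 2, ?_⟩
  have := wedge_sq_smul p r a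
  rw [ha, zero_smul, add_zero, sub_eq_add_neg, ← neg_smul] at this
  rw [div_eq_inv_mul, div_eq_inv_mul, mul_smul, mul_smul, ← smul_add, ← this, smul_smul,
    inv_mul_cancel₀ (pow_ne_zero 2 h), one_smul]

lemma apolar_smul_right (p : Fin 2 → ℂ) (c : ℂ) (a : Fin 3 → ℂ) :
    apolar p (c • p) a = c * apolar p p a := by
  simp [apolar]
  ring

/-- Two points of the plane of a conic lie in the span of two common points of the conic, or in a
common tangent line. -/
lemma exists_common_secant_or_tangent (a b : Fin 3 → ℂ) : ∃ p r : Fin 2 → ℂ, wedge p r ≠ 0 ∧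
    ((∃ x y x' y' : ℂ, a = x • conicVector p + y • conicVector r ∧
      b = x' • conicVector p + y' • conicVector r) ∨
    (∃ x y x' y' : ℂ, a = x • conicVector p + y • conicPolar p r ∧
      b = x' • conicVector p + y' • conicPolar p r)) := by
  obtain ⟨p, r, hp, hr, ha, hb⟩ := exists_apolar_eq_zero a b
  by_cases h : wedge p r = 0
  -- A double root: the common line is the tangent at `p`, and any independent `s` gives its
  -- direction.
  · obtain ⟨c, rfl⟩ := exists_smul_of_wedge_eq_zero hp h
    have hc : c ≠ 0 := by
      rintro rfl
      simp at hr
    rw [apolar_smul_right] at ha hb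
    obtain ⟨s, hs⟩ := exists_wedge_ne_zero hp
    obtain ⟨x, y, hx⟩ := exists_tangent_conic hs ((mul_eq_zero.1 ha).resolve_left hc)
    obtain ⟨x', y', hx'⟩ := exists_tangent_conic hs ((mul_eq_zero.1 hb).resolve_left hc)
    exact ⟨p, s, hs, Or.inr ⟨x, y, x', y', hx, hx'⟩⟩
  · obtain ⟨x, y, hx⟩ := exists_secant_conic h ha
    obtain ⟨x', y', hx'⟩ := exists_secant_conic h hb
    exact ⟨p, r, h, Or.inl ⟨x, y, x', y', hx, hx'⟩⟩

/-- Every point of three-space lies on a secant or a tangent line of the twisted cubic. -/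
lemma exists_secant_or_tangent_cubic (q : Fin 4 → ℂ) : ∃ p r : Fin 2 → ℂ, wedge p r ≠ 0 ∧
    ∃ x y : ℂ, q = x • cubicVector p + y • cubicVector r ∨
      q = x • cubicVector p + y • cubicDeriv p r := by
  -- The two vectors are the rows of the 2 × 3 Hankel matrix of `q`. Their overlap in `q 1` and `q
  -- 2` ties the two expansions together.
  obtain ⟨p, r, h, ⟨x, y, x', y', ha, hb⟩ | ⟨x, y, x', y', ha, hb⟩⟩ :=
    exists_common_secant_or_tangent ![q 0, q 1, q 2] ![q 1, q 2, q 3]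
  all_goals
    obtain ⟨hp, hr⟩ := ne_zero_of_wedge_ne_zero h
    have a0 := congrFun ha 0
    have a1 := congrFun ha 1
    have a2 := congrFun ha 2
    have b0 := congrFun hb 0
    have b1 := congrFun hb 1
    have b2 := congrFun hb 2
    simp [conicVector, conicPolar] at a0 a1 a2 b0 b1 b2
    refine ⟨p, r, h, ?_⟩
  -- Equating the overlapping entries gives a linear relation between the independent `p` and `r`,
  -- so (x, x') is proportional to `p` and (y, y') to `r`.
  · obtain ⟨e1, e2⟩ := eq_zero_of_wedge_ne_zero h (x := x * p 1 - x' * p 0)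
      (y := y * r 1 - y' * r 0) (by linear_combination b0 - a1) (by linear_combination b1 - a2)
    obtain ⟨c, rfl, rfl⟩ := exists_eq_mul_of_mul_eq hp (sub_eq_zero.1 e1)
    obtain ⟨d, rfl, rfl⟩ := exists_eq_mul_of_mul_eq hr (sub_eq_zero.1 e2)
    refine ⟨c, d, Or.inl (funext fun i => ?_)⟩
    fin_cases i <;> simp [cubicVector, a0, a1, a2, b2] <;> ring
  · obtain ⟨e1, e2⟩ := eq_zero_of_wedge_ne_zero h
      (x := x * p 1 + y * r 1 - x' * p 0 - y' * r 0) (y := y * p 1 - y' * p 0)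
      (by linear_combination b0 - a1) (by linear_combination b1 - a2)
    obtain ⟨c, rfl, rfl⟩ := exists_eq_mul_of_mul_eq hp (sub_eq_zero.1 e2)
    obtain ⟨d, h1, h2⟩ := exists_eq_mul_of_mul_eq hp (x := x - c * r 0) (y := x' - c * r 1)
      (by linear_combination e1)
    obtain rfl : x = d * p 0 + c * r 0 := by linear_combination h1
    obtain rfl : x' = d * p 1 + c * r 1 := by linear_combination h2
    refine ⟨d, c, Or.inr (funext fun i => ?_)⟩
    fin_cases i <;> simp [cubicVector, cubicDeriv, a0, a1, a2, b2] <;> ring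

/-! ### Expansion in monomials and invertibility of the coordinate matrix -/

open MvPolynomial in
/-- A homogeneous polynomial is a combination of the monomials of its degree. -/
lemma exists_eq_sum_smul {K : Type*} [Fintype K] {n : ℕ} {cls : ℤ × ℤ}
    {f : K → MvPolynomial CoxIndex ℂ}
    (hf : ∀ d : CoxIndex →₀ ℕ, Finsupp.weight (coxWeight n) d = cls →
      ∃ k, f k = ∏ i, X i ^ d i)
    {F : MvPolynomial CoxIndex ℂ} (hF : F.IsWeightedHomogeneous (coxWeight n) cls) :
    ∃ c : K → ℂ, F = ∑ k, c k • f k := by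
  have h : F ∈ Submodule.span ℂ (Set.range f) := by
    rw [F.as_sum]
    refine Submodule.sum_mem _ fun d hd => ?_
    obtain ⟨k, hk⟩ := hf d (hF (mem_support_iff.1 hd))
    rw [monomial_eq, Finsupp.prod_fintype _ _ (fun _ => pow_zero _), ← hk, ← smul_eq_C_mul]
    exact Submodule.smul_mem _ _ (Submodule.subset_span ⟨k, rfl⟩)
  obtain ⟨c, hc⟩ := (Submodule.mem_span_range_iff_exists_fun ℂ).1 h
  exact ⟨c, hc.symm⟩

lemma weight_coxWeight (n : ℕ) (d : CoxIndex →₀ ℕ) :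
    Finsupp.weight (coxWeight n) d = ((d (Sum.inr 0) + d (Sum.inr 1) : ℤ),
      (d (Sum.inl 0) + d (Sum.inl 1) + n * d (Sum.inr 1) : ℤ)) := by
  rw [Finsupp.weight_apply, Finsupp.sum_fintype _ _ (by simp)]
  ext <;> simp [coxWeight, Fintype.sum_sum_type, mul_comm]

/-- A matrix of coordinates of an embedding is invertible if every vector is on a secant or a
tangent. -/
lemma HirzebruchEmbedding.mulVec_injective {n : ℕ} {φ : HirzebruchEmbedding n} {K : Type*}
    [Fintype K] {f : K → MvPolynomial CoxIndex ℂ} {m : Matrix (Fin 6) K ℂ}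
    (hm : ∀ i, φ.coord i = ∑ k, m i k • f k)
    (hf : ∀ p q, CoxPoint.Equiv n p q → ∃ c : ℂ, coxValues f q.1 = c • coxValues f p.1)
    (hf0 : ∀ z : Fin 2 → ℂ, coxValues f (Sum.elim z 0) = 0)
    (hE : ∀ p : CoxPoint, ∃ E : CoxIndex → ℂ, E ≠ 0 ∧ coxDeriv f p.1 E = 0)
    (hcover : ∀ c : K → ℂ,
      (∃ z₁ w₁ z₂ w₂ : Fin 2 → ℂ, z₁ ≠ 0 ∧ z₂ ≠ 0 ∧
        c = coxValues f (Sum.elim z₁ w₁) + coxValues f (Sum.elim z₂ w₂)) ∨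
      ∃ (z w : Fin 2 → ℂ) (a : CoxIndex → ℂ), z ≠ 0 ∧ w ≠ 0 ∧ c = coxDeriv f (Sum.elim z w) a) :
    Function.Injective m.mulVecLin := by
  rw [← LinearMap.ker_eq_bot, LinearMap.ker_eq_bot']
  intro c hc
  rw [Matrix.mulVecLin_apply] at hc
  obtain ⟨z₁, w₁, z₂, w₂, hz₁, hz₂, rfl⟩ | ⟨z, w, a, hz, hw, rfl⟩ := hcover c
  · exact φ.secant_eq_zero hm hf hf0 hz₁ hz₂ hc
  · exact φ.tangent_eq_zero hm hE hz hw hc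

/-! ### Segre coordinates on `𝔽 0` -/

open MvPolynomial in
/-- The six monomials of class `e + 2 f` on `𝔽 0`. -/
noncomputable def segreMonomial : Fin 2 × Fin 3 → MvPolynomial CoxIndex ℂ := fun k =>
  X (Sum.inr k.1) *
    ![X (Sum.inl 0) ^ 2, X (Sum.inl 0) * X (Sum.inl 1), X (Sum.inl 1) ^ 2] k.2

lemma coxValues_segreMonomial (z w : Fin 2 → ℂ) :
    coxValues segreMonomial (Sum.elim z w) = segreVector w (conicVector z) := by
  funext ⟨i, j⟩
  fin_cases j <;> simp [coxValues, segreMonomial, segreVector, conicVector]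

lemma coxDeriv_segreMonomial (z w r u : Fin 2 → ℂ) :
    coxDeriv segreMonomial (Sum.elim z w) (Sum.elim r u) =
      segreVector u (conicVector z) + segreVector w (conicPolar z r) := by
  funext ⟨i, j⟩
  fin_cases i <;> fin_cases j <;>
    simp [coxDeriv, segreMonomial, segreVector, conicVector, conicPolar, Fintype.sum_sum_type,
      Derivation.leibniz, Derivation.leibniz_pow, MvPolynomial.pderiv_X, Pi.single_apply] <;> ring

/-- The two rows of the 2 × 3 matrix `c` lie on a common chord or tangent of the conic. Collecting
their coefficients into vectors of ℂ² makes `c` a secant or tangent vector of ℙ¹ × conic. -/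
lemma exists_segre_secant_or_tangent (c : Fin 2 × Fin 3 → ℂ) :
    (∃ z₁ w₁ z₂ w₂ : Fin 2 → ℂ, z₁ ≠ 0 ∧ z₂ ≠ 0 ∧
      c = coxValues segreMonomial (Sum.elim z₁ w₁) + coxValues segreMonomial (Sum.elim z₂ w₂)) ∨
    ∃ (z w : Fin 2 → ℂ) (a : CoxIndex → ℂ), z ≠ 0 ∧ w ≠ 0 ∧
      c = coxDeriv segreMonomial (Sum.elim z w) a := by
  obtain ⟨p, r, h, ⟨x, y, x', y', ha, hb⟩ | ⟨x, y, x', y', ha, hb⟩⟩ :=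
    exists_common_secant_or_tangent (fun j => c (0, j)) (fun j => c (1, j))
  all_goals obtain ⟨hp, hr⟩ := ne_zero_of_wedge_ne_zero h
  · refine Or.inl ⟨p, ![x, x'], r, ![y, y'], hp, hr, ?_⟩
    rw [coxValues_segreMonomial, coxValues_segreMonomial]
    funext ⟨i, j⟩
    fin_cases i
    · simpa [segreVector] using congrFun ha j
    · simpa [segreVector] using congrFun hb j
  · have hc : c = segreVector ![x, x'] (conicVector p) + segreVector ![y, y'] (conicPolar p r) := by
      funext ⟨i, j⟩
      fin_cases i
      · simpa [segreVector] using congrFun ha j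
      · simpa [segreVector] using congrFun hb j
    by_cases hw : ![y, y'] = 0
    · refine Or.inl ⟨p, ![x, x'], p, 0, hp, hp, ?_⟩
      rw [coxValues_segreMonomial, coxValues_segreMonomial, hc, hw]
      funext ⟨i, j⟩
      simp [segreVector]
    · refine Or.inr ⟨p, ![y, y'], Sum.elim r ![x, x'], hp, hw, ?_⟩
      rw [coxDeriv_segreMonomial, hc]

/-- A quartic scroll `𝔽 0` is the image of the standard one by a linear isomorphism. -/
lemma exists_segre_coordinates (φ : HirzebruchEmbedding 0) (hφ : φ.IsQuarticScroll) :
    ∃ g : (Fin 2 × Fin 3 → ℂ) ≃ₗ[ℂ] (Fin 6 → ℂ), ∀ x, x ∈ φ.surface ↔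
      ∃ z w, z ≠ 0 ∧ w ≠ 0 ∧ HasCoords x (g (segreVector w (conicVector z))) := by
  obtain ⟨h1, h2⟩ := hφ
  have hcls : φ.cls = (1, 2) := by
    ext
    · simpa [interNumber] using h1
    · simp only [interNumber] at h1 h2
      have : φ.cls.1 = 1 := by simpa using h1
      rw [this] at h2
      push_cast at h2
      change φ.cls.2 = 2
      linarith
  have hmon : ∀ d : CoxIndex →₀ ℕ, Finsupp.weight (coxWeight 0) d = (1, 2) →
      ∃ k, segreMonomial k = ∏ i, MvPolynomial.X i ^ d i := by
    intro d hd
    rw [weight_coxWeight, Prod.mk.injEq] at hd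
    simp only [Fintype.prod_sum_type, Fin.prod_univ_two]
    obtain ⟨ha, hb⟩ := hd
    have ha' : (d (Sum.inr 0) = 1 ∧ d (Sum.inr 1) = 0) ∨ (d (Sum.inr 0) = 0 ∧ d (Sum.inr 1) = 1) := by
      omega
    have hb' : (d (Sum.inl 0) = 2 ∧ d (Sum.inl 1) = 0) ∨ (d (Sum.inl 0) = 1 ∧ d (Sum.inl 1) = 1) ∨
        (d (Sum.inl 0) = 0 ∧ d (Sum.inl 1) = 2) := by
      push_cast at hb
      omega
    rcases ha' with ⟨e1, e2⟩ | ⟨e1, e2⟩ <;> rcases hb' with ⟨e3, e4⟩ | ⟨e3, e4⟩ | ⟨e3, e4⟩ <;>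
      rw [e1, e2, e3, e4]
    · exact ⟨(0, 0), by simp [segreMonomial]; ring⟩
    · exact ⟨(0, 1), by simp [segreMonomial]; ring⟩
    · exact ⟨(0, 2), by simp [segreMonomial]; ring⟩
    · exact ⟨(1, 0), by simp [segreMonomial]; ring⟩
    · exact ⟨(1, 1), by simp [segreMonomial]; ring⟩
    · exact ⟨(1, 2), by simp [segreMonomial]; ring⟩
  choose m hm using fun i => exists_eq_sum_smul hmon (hcls ▸ φ.homogeneous i)
  have hinj : Function.Injective (Matrix.of m).mulVecLin := by
    refine φ.mulVec_injective (m := Matrix.of m) hm ?_ ?_ ?_ exists_segre_secant_or_tangent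
    · intro p q hpq
      obtain ⟨z, w, hz, hw, rfl⟩ := p.exists_of
      obtain ⟨z', w', hz', hw', rfl⟩ := q.exists_of
      obtain ⟨a, b, k1, k2, k3⟩ := hpq
      refine ⟨a ^ 2 * b, ?_⟩
      change coxValues segreMonomial (Sum.elim z' w') =
        (a ^ 2 * b : ℂ) • coxValues segreMonomial (Sum.elim z w)
      simp only [CoxPoint.of, Sum.elim_inl, Sum.elim_inr, pow_zero, mul_one] at k1 k2 k3
      rw [coxValues_segreMonomial, coxValues_segreMonomial]
      funext ⟨i, j⟩
      fin_cases i <;> fin_cases j <;> simp [segreVector, conicVector, k1, k2, k3] <;> ring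
    · intro z
      rw [coxValues_segreMonomial]
      funext ⟨i, j⟩
      simp [segreVector]
    · intro p
      obtain ⟨z, w, hz, hw, rfl⟩ := p.exists_of
      -- The monomials are quadratic in `z` and linear in `w`, so these weights cancel in Euler's
      -- formula.
      refine ⟨Sum.elim z (-2 * w), ?_, ?_⟩
      · intro h
        exact hz (funext fun i => congrFun h (Sum.inl i))
      · change coxDeriv segreMonomial (Sum.elim z w) _ = 0
        rw [coxDeriv_segreMonomial]
        funext ⟨i, j⟩
        fin_cases j <;> simp [segreVector, conicVector, conicPolar] <;> ring
  refine ⟨(Matrix.of m).mulVecLin.linearEquivOfInjective hinj (by simp), fun x => ?_⟩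
  rw [φ.mem_surface_iff (m := Matrix.of m) hm]
  simp only [coxValues_segreMonomial, LinearMap.linearEquivOfInjective_apply,
    Matrix.mulVecLin_apply]

/-! ### The quadric section of the Segre product -/

open MvPolynomial in
/-- The equation of the conic as a form of bidegree `(0, 2)`. -/
noncomputable def conicForm : MvPolynomial (Fin 2 ⊕ Fin 3) ℂ :=
  X (Sum.inr 0) * X (Sum.inr 2) - X (Sum.inr 1) ^ 2

open MvPolynomial in
-- A square factor divides every partial derivative, in particular two distinct variables, so it is
-- a unit.
lemma squarefree_conicForm : Squarefree conicForm := by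
  rintro a ⟨b, hb⟩
  have hd : ∀ i, a ∣ pderiv i conicForm := by
    intro i
    rw [hb]
    simp only [Derivation.leibniz, smul_eq_mul]
    exact ⟨a * pderiv i b + b * pderiv i a + b * pderiv i a, by ring⟩
  have h0 : a ∣ X (Sum.inr 2) := by
    simpa [conicForm, pderiv_X, Pi.single_apply] using hd (Sum.inr 0)
  have h2 : a ∣ X (Sum.inr 0) := by
    simpa [conicForm, pderiv_X, Pi.single_apply] using hd (Sum.inr 2)
  by_contra hu
  have h := (X_prime (R := ℂ) (i := (Sum.inr 2 : Fin 2 ⊕ Fin 3))).irreducible.dvd_iff.1 h0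
  have h3 := (h.resolve_left hu).dvd.trans h2
  rw [X_dvd_X] at h3
  simp at h3

open MvPolynomial in
lemma isWeightedHomogeneous_conicForm : conicForm.IsWeightedHomogeneous segreWeight (0, 2) := by
  have h := fun i => isWeightedHomogeneous_X ℂ segreWeight (Sum.inr i : Fin 2 ⊕ Fin 3)
  exact ((h 0).mul (h 2)).sub ((h 1).pow 2)

lemma eval_conicForm (z : Fin 2 → ℂ) (x : Fin 3 → ℂ) :
    MvPolynomial.eval (Sum.elim z x) conicForm = x 0 * x 2 - x 1 ^ 2 := by
  simp [conicForm]

/-- A form of bidegree `(0, 2)` does not involve the coordinates of the line. -/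
lemma eval_eq_of_bidegree_zero_left {F : MvPolynomial (Fin 2 ⊕ Fin 3) ℂ} {b : ℕ}
    (hF : F.IsWeightedHomogeneous segreWeight (0, b)) (z z' : Fin 2 → ℂ) (x : Fin 3 → ℂ) :
    MvPolynomial.eval (Sum.elim z x) F = MvPolynomial.eval (Sum.elim z' x) F := by
  rw [MvPolynomial.eval_eq', MvPolynomial.eval_eq']
  refine Finset.sum_congr rfl fun d hd => ?_
  have h := congrArg Prod.fst (hF (MvPolynomial.mem_support_iff.1 hd))
  rw [Finsupp.weight_apply, Finsupp.sum_fintype _ _ (by simp)] at h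
  simp [segreWeight, Fintype.sum_sum_type] at h
  simp [Fintype.prod_sum_type, h]

lemma conicVector_ne_zero {y : Fin 2 → ℂ} (hy : y ≠ 0) : conicVector y ≠ 0 := by
  intro h
  rcases fin_two_ne_zero hy with h0 | h0
  · exact h0 (by simpa [conicVector] using congrFun h 0)
  · exact h0 (by simpa [conicVector] using congrFun h 2)

lemma conicVector_smul (c : ℂ) (y : Fin 2 → ℂ) : conicVector (c • y) = c ^ 2 • conicVector y := by
  funext i
  fin_cases i <;> simp [conicVector] <;> ring

/-- The conic is parametrised up to scalars by `conicVector`. -/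
lemma exists_conicVector_smul {x : Fin 3 → ℂ} (hx : x ≠ 0) (h : x 0 * x 2 - x 1 ^ 2 = 0) :
    ∃ (y : Fin 2 → ℂ) (c : ℂ), y ≠ 0 ∧ c ≠ 0 ∧ x = c • conicVector y := by
  by_cases h0 : x 0 = 0
  · have h1 : x 1 = 0 := by simpa [h0] using h
    refine ⟨![0, 1], x 2, by simp, fun h2 => hx (funext fun i => ?_), funext fun i => ?_⟩
    · fin_cases i <;> simp [h0, h1, h2]
    · fin_cases i <;> simp [conicVector, h0, h1]
  · refine ⟨![x 0, x 1], (x 0)⁻¹, by simp [h0], by simp [h0], funext fun i => ?_⟩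
    fin_cases i <;> simp [conicVector] <;> field_simp
    linear_combination h

lemma segreVector_smul_left (c : ℂ) (z : Fin 2 → ℂ) (x : Fin 3 → ℂ) :
    segreVector (c • z) x = c • segreVector z x := by
  funext k
  simp [segreVector, mul_assoc]

lemma segreVector_smul_right (c : ℂ) (z : Fin 2 → ℂ) (x : Fin 3 → ℂ) :
    segreVector z (c • x) = c • segreVector z x := by
  funext k
  simp [segreVector, mul_left_comm]

lemma segreVector_add_left (z z' : Fin 2 → ℂ) (x : Fin 3 → ℂ) :
    segreVector (z + z') x = segreVector z x + segreVector z' x := by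
  funext k
  simp [segreVector, add_mul]

lemma segreVector_add_right (z : Fin 2 → ℂ) (x x' : Fin 3 → ℂ) :
    segreVector z (x + x') = segreVector z x + segreVector z x' := by
  funext k
  simp [segreVector, mul_add]

lemma segreVector_ne_zero {z : Fin 2 → ℂ} {x : Fin 3 → ℂ} (hz : z ≠ 0) (hx : x ≠ 0) :
    segreVector z x ≠ 0 := by
  obtain ⟨i, hi⟩ := Function.ne_iff.1 hz
  obtain ⟨j, hj⟩ := Function.ne_iff.1 hx
  exact fun h => mul_ne_zero hi hj (congrFun h (i, j))

/-- The Segre product of a scroll in standard coordinates contains it as a divisor in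
`|𝒪(0,2)|`. -/
lemma isSegreDivisor_of_scroll {g : (Fin 2 × Fin 3 → ℂ) ≃ₗ[ℂ] (Fin 6 → ℂ)} {R : Set P5}
    (hR : ∀ x, x ∈ R ↔ ∃ z w, z ≠ 0 ∧ w ≠ 0 ∧ HasCoords x (g (segreVector w (conicVector z)))) :
    IsSegreDivisor g 0 2 R := by
  refine ⟨conicForm, isWeightedHomogeneous_conicForm, squarefree_conicForm, Set.ext fun p => ?_⟩
  rw [hR]
  constructor
  · rintro ⟨z, w, hz, hw, h⟩
    refine ⟨w, conicVector z, hw, conicVector_ne_zero hz, ?_, h⟩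
    rw [eval_conicForm]
    simp [conicVector]
    ring
  · rintro ⟨w, x, hw, hx, hF, h⟩
    rw [eval_conicForm] at hF
    obtain ⟨y, c, hy, hc, rfl⟩ := exists_conicVector_smul hx hF
    refine ⟨y, c • w, hy, smul_ne_zero hc hw, ?_⟩
    rwa [segreVector_smul_left, ← segreVector_smul_right]

/-! ### Rigidity of the Segre product -/

/-- On the conic the pairing is the product of the two linear forms, which allows evaluation at
chosen roots. -/
lemma apolar_conicVector (p r y : Fin 2 → ℂ) :
    apolar p r (conicVector y) = wedge p y * wedge r y := by
  simp [apolar, conicVector, wedge]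
  ring

/-- Two points of `ℙ¹ ×` conic on a line contained in the surface lie over the same point of the
conic. -/
lemma wedge_eq_zero_of_segre_add {w w' w'' y y' y'' : Fin 2 → ℂ} (hw : w ≠ 0) (hw' : w' ≠ 0)
    (hy'' : y'' ≠ 0)
    (h : segreVector w (conicVector y) + segreVector w' (conicVector y') =
      segreVector w'' (conicVector y'')) : wedge y y' = 0 := by
  have key : ∀ (p r : Fin 2 → ℂ) (i : Fin 2), w i * (wedge p y * wedge r y) +
      w' i * (wedge p y' * wedge r y') = w'' i * (wedge p y'' * wedge r y'') := by
    intro p r i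
    have h0 := congrFun h (i, 0)
    have h1 := congrFun h (i, 1)
    have h2 := congrFun h (i, 2)
    simp only [segreVector, Pi.add_apply] at h0 h1 h2
    simp only [← apolar_conicVector, apolar]
    linear_combination p 1 * r 1 * h0 - (p 0 * r 1 + p 1 * r 0) * h1 + p 0 * r 0 * h2
  by_contra hne
  have hself : ∀ a : Fin 2 → ℂ, wedge a a = 0 := fun a => by
    rw [wedge]
    ring
  have hswap : wedge y' y ≠ 0 := by
    rw [show wedge y' y = -wedge y y' by rw [wedge, wedge]; ring]
    exact neg_ne_zero.2 hne
  obtain ⟨i, hi⟩ := Function.ne_iff.1 hw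
  obtain ⟨j, hj⟩ := Function.ne_iff.1 hw'
  rw [Pi.zero_apply] at hi hj
  -- Contracting with the quadric with roots `y''` and `y` kills two of the three terms and leaves
  -- only the one at `y'`.
  have e1 : wedge y'' y' = 0 := by
    have := key y'' y j
    simpa [hself, hne, hj] using this
  have e2 : wedge y'' y = 0 := by
    have := key y'' y' i
    simpa [hself, hswap, hi] using this
  obtain ⟨a, rfl⟩ := exists_smul_of_wedge_eq_zero hy'' e1
  obtain ⟨b, rfl⟩ := exists_smul_of_wedge_eq_zero hy'' e2
  apply hne
  simp [wedge]
  ring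

section Rigidity

variable (h : (Fin 2 × Fin 3 → ℂ) ≃ₗ[ℂ] (Fin 2 × Fin 3 → ℂ)) {Z : Set (Fin 3 → ℂ)}
  (h₁ : ∀ z x, z ≠ 0 → x ≠ 0 → x ∈ Z →
    ∃ w y, w ≠ 0 ∧ y ≠ 0 ∧ h (segreVector z x) = segreVector w (conicVector y))
  (h₂ : ∀ w y, w ≠ 0 → y ≠ 0 →
    ∃ z x, z ≠ 0 ∧ x ≠ 0 ∧ x ∈ Z ∧ h (segreVector z x) = segreVector w (conicVector y))

include h₁ h₂

/-- The rulings over the points of the conic correspond to each other. -/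
lemma exists_ruling {y : Fin 2 → ℂ} (hy : y ≠ 0) : ∃ (x : Fin 3 → ℂ)
    (A : (Fin 2 → ℂ) →ₗ[ℂ] (Fin 2 → ℂ)), Function.Injective A ∧
      ∀ z, h (segreVector z x) = segreVector (A z) (conicVector y) := by
  have hw : (![1, 0] : Fin 2 → ℂ) ≠ 0 := by simp
  obtain ⟨z₀, x, hz₀, hx, hxZ, e₀⟩ := h₂ _ y hw hy
  have main : ∀ z, ∃ w, h (segreVector z x) = segreVector w (conicVector y) := by
    intro z
    by_cases hd : wedge z₀ z = 0
    · obtain ⟨c, rfl⟩ := exists_smul_of_wedge_eq_zero hz₀ hd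
      exact ⟨c • ![1, 0], by rw [segreVector_smul_left, map_smul, e₀, segreVector_smul_left]⟩
    · have hz : z ≠ 0 := (ne_zero_of_wedge_ne_zero hd).2
      have hzz : z₀ + z ≠ 0 := by
        intro hs
        rw [eq_neg_of_add_eq_zero_right hs] at hd
        apply hd
        simp [wedge]
        ring
      -- The images of `z₀`, `z` and `z₀ + z` are three points of R on one line, so they lie over
      -- the same conic point.
      obtain ⟨w', y', hw', hy', e'⟩ := h₁ z x hz hx hxZ
      obtain ⟨w'', y'', hw'', hy'', e''⟩ := h₁ (z₀ + z) x hzz hx hxZ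
      rw [segreVector_add_left, map_add, e₀, e'] at e''
      obtain ⟨c, rfl⟩ := exists_smul_of_wedge_eq_zero hy
        (wedge_eq_zero_of_segre_add hw hw' hy'' e'')
      exact ⟨c ^ 2 • w', by
        rw [e', conicVector_smul, segreVector_smul_left, segreVector_smul_right]⟩
  obtain ⟨j, hj⟩ := Function.ne_iff.1 (conicVector_ne_zero hy)
  rw [Pi.zero_apply] at hj
  let A : (Fin 2 → ℂ) →ₗ[ℂ] (Fin 2 → ℂ) :=
    { toFun := fun z i => h (segreVector z x) (i, j) / conicVector y j
      map_add' := fun z z' => by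
        funext i
        simp [segreVector_add_left, add_div]
      map_smul' := fun c z => by
        funext i
        simp [segreVector_smul_left, mul_div_assoc] }
  have hA : ∀ z, h (segreVector z x) = segreVector (A z) (conicVector y) := by
    intro z
    obtain ⟨w, hw⟩ := main z
    have : A z = w := by
      funext i
      change h (segreVector z x) (i, j) / conicVector y j = w i
      rw [hw, segreVector]
      field_simp
    rw [hw, this]
  refine ⟨x, A, ?_, hA⟩
  rw [← LinearMap.ker_eq_bot, LinearMap.ker_eq_bot']
  intro z hz
  by_contra hne
  apply segreVector_ne_zero hne hx
  apply h.injective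
  rw [hA, hz, map_zero]
  funext k
  simp [segreVector]

/-- A linear map that identifies `ℙ¹ ×` (a subset of the plane) with `ℙ¹ ×` conic is the product of
linear maps of the factors. -/
lemma exists_segre_factors : ∃ (A : (Fin 2 → ℂ) ≃ₗ[ℂ] (Fin 2 → ℂ))
    (B : (Fin 3 → ℂ) ≃ₗ[ℂ] (Fin 3 → ℂ)),
      ∀ z x, h (segreVector z x) = segreVector (A z) (B x) := by
  -- The conic points are v₁ = (1,0,0), v₂ = (0,0,1), v₃ = (1,1,1) and v₄ = (1,-1,1) = 2v₁ + 2v₂ -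
  -- v₃. The first three form a basis, and the relation makes all the `Aᵢ` proportional to `A₄`.
  obtain ⟨x₁, A₁, i₁, e₁⟩ := exists_ruling h h₁ h₂ (y := ![1, 0]) (by simp)
  obtain ⟨x₂, A₂, i₂, e₂⟩ := exists_ruling h h₁ h₂ (y := ![0, 1]) (by simp)
  obtain ⟨x₃, A₃, i₃, e₃⟩ := exists_ruling h h₁ h₂ (y := ![1, 1]) (by simp)
  obtain ⟨x₄, A₄, i₄, e₄⟩ := exists_ruling h h₁ h₂ (y := ![1, -1]) (by simp)
  set L := Fintype.linearCombination ℂ ![x₁, x₂, x₃] with hL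
  have hLh : ∀ z b, h (segreVector z (L b)) = segreVector (b 0 • A₁ z) (conicVector ![1, 0]) +
      segreVector (b 1 • A₂ z) (conicVector ![0, 1]) +
      segreVector (b 2 • A₃ z) (conicVector ![1, 1]) := by
    intro z b
    simp [hL, Fintype.linearCombination_apply, Fin.sum_univ_three, segreVector_add_right,
      segreVector_smul_right, segreVector_smul_left, e₁, e₂, e₃]
  have hcomp : ∀ z b i, h (segreVector z (L b)) (i, 0) = b 0 * A₁ z i + b 2 * A₃ z i ∧
      h (segreVector z (L b)) (i, 1) = b 2 * A₃ z i ∧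
      h (segreVector z (L b)) (i, 2) = b 1 * A₂ z i + b 2 * A₃ z i := by
    intro z b i
    rw [hLh]
    simp [segreVector, conicVector]
  have hne : ∀ A : (Fin 2 → ℂ) →ₗ[ℂ] (Fin 2 → ℂ), Function.Injective A →
      ∃ z i, A z i ≠ 0 := by
    intro A hA
    have : A ![1, 0] ≠ 0 := (map_ne_zero_iff A hA).2 (by simp)
    exact ⟨_, Function.ne_iff.1 this⟩
  have hLinj : Function.Injective L := by
    rw [← LinearMap.ker_eq_bot, LinearMap.ker_eq_bot']
    intro b hb
    have hz : ∀ z i, b 0 * A₁ z i + b 2 * A₃ z i = 0 ∧ b 2 * A₃ z i = 0 ∧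
        b 1 * A₂ z i + b 2 * A₃ z i = 0 := by
      intro z i
      have h0 : segreVector z (L b) = 0 := by
        rw [hb]
        funext k
        simp [segreVector]
      have := hcomp z b i
      rw [h0, map_zero] at this
      simp only [Pi.zero_apply] at this
      exact ⟨this.1.symm, this.2.1.symm, this.2.2.symm⟩
    have hb2 : b 2 = 0 := by
      obtain ⟨z, i, hzi⟩ := hne A₃ i₃
      exact (mul_eq_zero.1 (hz z i).2.1).resolve_right hzi
    have hb0 : b 0 = 0 := by
      obtain ⟨z, i, hzi⟩ := hne A₁ i₁
      simpa [hb2, hzi] using (hz z i).1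
    have hb1 : b 1 = 0 := by
      obtain ⟨z, i, hzi⟩ := hne A₂ i₂
      simpa [hb2, hzi] using (hz z i).2.2
    funext i
    fin_cases i <;> simp [hb0, hb1, hb2]
  obtain ⟨c, rfl⟩ := LinearMap.injective_iff_surjective.1 hLinj x₄
  have hc : ∀ z i, c 0 * A₁ z i = 2 * A₄ z i ∧ c 1 * A₂ z i = 2 * A₄ z i ∧
      c 2 * A₃ z i = -A₄ z i := by
    intro z i
    obtain ⟨k0, k1, k2⟩ := hcomp z c i
    rw [e₄] at k0 k1 k2
    simp [segreVector, conicVector] at k0 k1 k2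
    refine ⟨?_, ?_, ?_⟩
    · linear_combination k1 - k0
    · linear_combination k1 - k2
    · linear_combination -k1
  obtain ⟨z₀, i₀, hz₀⟩ := hne A₄ i₄
  have hc0 : c 0 ≠ 0 := fun h0 => hz₀ (by simpa [h0] using (hc z₀ i₀).1)
  have hc1 : c 1 ≠ 0 := fun h0 => hz₀ (by simpa [h0] using (hc z₀ i₀).2.1)
  have hc2 : c 2 ≠ 0 := fun h0 => hz₀ (by simpa [h0] using (hc z₀ i₀).2.2)
  -- The columns are v₁, v₂, v₃ scaled by the ratios of `A₁`, `A₂`, `A₃` to `A₄`, so `D` is the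
  -- second factor in the basis `x₁, x₂, x₃`.
  set D := Fintype.linearCombination ℂ
    ![![2 / c 0, 0, 0], ![0, 0, 2 / c 1], ![-1 / c 2, -1 / c 2, -1 / c 2]] with hD
  have hDb : ∀ b, D b = ![b 0 * (2 / c 0) + b 2 * (-1 / c 2), b 2 * (-1 / c 2),
      b 1 * (2 / c 1) + b 2 * (-1 / c 2)] := by
    intro b
    funext j
    fin_cases j <;> simp [hD, Fintype.linearCombination_apply, Fin.sum_univ_three]
  have hDinj : Function.Injective D := by
    rw [← LinearMap.ker_eq_bot, LinearMap.ker_eq_bot']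
    intro b hb
    rw [hDb] at hb
    have k0 := congrFun hb 0
    have k1 := congrFun hb 1
    have k2 := congrFun hb 2
    simp [hc2] at k1
    simp [hc0, k1] at k0
    simp [hc1, k1] at k2
    funext i
    fin_cases i <;> simp [k0, k1, k2]
  let LE := LinearEquiv.ofInjectiveEndo L hLinj
  refine ⟨LinearEquiv.ofInjectiveEndo A₄ i₄, LE.symm.trans (LinearEquiv.ofInjectiveEndo D hDinj),
    fun z x => ?_⟩
  obtain ⟨b, rfl⟩ := LE.surjective x
  have hB : (LE.symm.trans (LinearEquiv.ofInjectiveEndo D hDinj)) (LE b) = D b := by simp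
  rw [hB]
  funext ⟨i, j⟩
  obtain ⟨k0, k1, k2⟩ := hcomp z b i
  obtain ⟨l0, l1, l2⟩ := hc z i
  have l0' : A₁ z i = 2 / c 0 * A₄ z i := by field_simp; linear_combination l0
  have l1' : A₂ z i = 2 / c 1 * A₄ z i := by field_simp; linear_combination l1
  have l2' : A₃ z i = -1 / c 2 * A₄ z i := by field_simp; linear_combination l2
  rw [l0', l2'] at k0
  rw [l2'] at k1
  rw [l1', l2'] at k2
  change h (segreVector z (L b)) (i, j) = A₄ z i * D b j
  rw [hDb]
  fin_cases j
  · exact k0.trans (by simp; ring)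
  · exact k1.trans (by simp; ring)
  · exact k2.trans (by simp; ring)

end Rigidity

/-! ### Existence and uniqueness of the Segre product -/

/-- The cubic Segre product containing a quartic scroll `𝔽 0` as an element of `|𝒪(0,2)|` exists
and is unique. -/
theorem existsUnique_cubicSegreProduct (φ : HirzebruchEmbedding 0) (hφ : φ.IsQuarticScroll) :
    ∃! S : Set P5, IsCubicSegreProductContaining 0 2 φ.surface S := by
  obtain ⟨g, hg⟩ := exists_segre_coordinates φ hφ
  refine ⟨segreProduct g, ⟨g, rfl, isSegreDivisor_of_scroll hg⟩, ?_⟩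
  rintro S ⟨g', rfl, F, hF, -, hR⟩
  have hmem : ∀ z x, z ≠ 0 → x ≠ 0 → MvPolynomial.eval (Sum.elim z x) F = 0 →
      ∃ w y, w ≠ 0 ∧ y ≠ 0 ∧
        (g'.trans g.symm) (segreVector z x) = segreVector w (conicVector y) := by
    intro z x hz hx hFx
    have hv : g' (segreVector z x) ≠ 0 := by simpa using segreVector_ne_zero hz hx
    have hp : Projectivization.mk ℂ _ hv ∈ φ.surface := by
      rw [hR]
      exact ⟨z, x, hz, hx, hFx, hasCoords_mk hv⟩
    obtain ⟨y, w, hy, hw, hc⟩ := (hg _).1 hp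
    obtain ⟨c, hc0, e⟩ := hc.exists_smul_eq (hasCoords_mk hv)
    refine ⟨c • w, y, smul_ne_zero hc0 hw, hy, ?_⟩
    rw [segreVector_smul_left, LinearEquiv.trans_apply, e, ← map_smul, LinearEquiv.symm_apply_apply]
  have hmem' : ∀ w y, w ≠ 0 → y ≠ 0 → ∃ z x, z ≠ 0 ∧ x ≠ 0 ∧
      MvPolynomial.eval (Sum.elim z x) F = 0 ∧
        (g'.trans g.symm) (segreVector z x) = segreVector w (conicVector y) := by
    intro w y hw hy
    have hv : g (segreVector w (conicVector y)) ≠ 0 := by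
      simpa using segreVector_ne_zero hw (conicVector_ne_zero hy)
    have hp : Projectivization.mk ℂ _ hv ∈ φ.surface := (hg _).2 ⟨y, w, hy, hw, hasCoords_mk hv⟩
    rw [hR] at hp
    obtain ⟨z, x, hz, hx, hFx, hc⟩ := hp
    obtain ⟨c, hc0, e⟩ := hc.exists_smul_eq (hasCoords_mk hv)
    refine ⟨c • z, x, smul_ne_zero hc0 hz, hx, ?_, ?_⟩
    · rw [← hFx]
      exact eval_eq_of_bidegree_zero_left hF _ _ _
    · rw [segreVector_smul_left, LinearEquiv.trans_apply, map_smul, ← e,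
        LinearEquiv.symm_apply_apply]
  -- `F` has degree zero in the coordinates of ℙ¹, so its zero locus in the plane can be read off at
  -- `0`.
  obtain ⟨A, B, hAB⟩ := exists_segre_factors (g'.trans g.symm)
    (Z := {x | MvPolynomial.eval (Sum.elim 0 x) F = 0})
    (fun z x hz hx hxZ => hmem z x hz hx ((eval_eq_of_bidegree_zero_left hF _ _ _).trans hxZ))
    (fun w y hw hy => by
      obtain ⟨z, x, hz, hx, hFx, e⟩ := hmem' w y hw hy
      exact ⟨z, x, hz, hx, (eval_eq_of_bidegree_zero_left hF _ _ _).trans hFx, e⟩)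
  have hg' : ∀ z x, g' (segreVector z x) = g (segreVector (A z) (B x)) := by
    intro z x
    rw [← hAB]
    simp
  ext p
  constructor
  · rintro ⟨z, x, hz, hx, hc⟩
    exact ⟨A z, B x, by simpa using hz, by simpa using hx, hg' z x ▸ hc⟩
  · rintro ⟨z, x, hz, hx, hc⟩
    refine ⟨A.symm z, B.symm x, by simpa using hz, by simpa using hx, ?_⟩
    rw [hg']
    simpa using hc

/-! ### Coordinates on `𝔽 2` -/

open MvPolynomial in
/-- The six monomials of class `e + 3 f` on `𝔽 2`. -/
noncomputable def scrollMonomial : Fin 4 ⊕ Fin 2 → MvPolynomial CoxIndex ℂ :=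
  Sum.elim (fun k => X (Sum.inr 0) * ![X (Sum.inl 0) ^ 3, X (Sum.inl 0) ^ 2 * X (Sum.inl 1),
    X (Sum.inl 0) * X (Sum.inl 1) ^ 2, X (Sum.inl 1) ^ 3] k)
    (fun k => X (Sum.inr 1) * X (Sum.inl k))

lemma coxValues_scrollMonomial (z w : Fin 2 → ℂ) :
    coxValues scrollMonomial (Sum.elim z w) = Sum.elim (w 0 • cubicVector z) (w 1 • z) := by
  funext k
  rcases k with k | k <;> fin_cases k <;> simp [coxValues, scrollMonomial, cubicVector]

lemma coxDeriv_scrollMonomial (z w r u : Fin 2 → ℂ) :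
    coxDeriv scrollMonomial (Sum.elim z w) (Sum.elim r u) =
      Sum.elim (u 0 • cubicVector z + w 0 • cubicDeriv z r) (u 1 • z + w 1 • r) := by
  funext k
  rcases k with k | k <;> fin_cases k <;>
    simp [coxDeriv, scrollMonomial, cubicVector, cubicDeriv, Fintype.sum_sum_type,
      Derivation.leibniz, Derivation.leibniz_pow, MvPolynomial.pderiv_X, Pi.single_apply] <;> ring

lemma exists_eq_smul_add_smul {p r : Fin 2 → ℂ} (h : wedge p r ≠ 0) (l : Fin 2 → ℂ) :
    ∃ a b : ℂ, l = a • p + b • r := by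
  refine ⟨wedge l r / wedge p r, wedge p l / wedge p r, ?_⟩
  funext i
  fin_cases i <;> simp <;> field_simp <;> simp only [wedge] <;> ring

/-- The parameters `p`, `r` of a secant or tangent through the cubic part are a basis of ℂ², so the
line part expands in the same `p` and `r`. -/
lemma exists_scroll_secant_or_tangent (c : Fin 4 ⊕ Fin 2 → ℂ) :
    (∃ z₁ w₁ z₂ w₂ : Fin 2 → ℂ, z₁ ≠ 0 ∧ z₂ ≠ 0 ∧
      c = coxValues scrollMonomial (Sum.elim z₁ w₁) +
        coxValues scrollMonomial (Sum.elim z₂ w₂)) ∨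
    ∃ (z w : Fin 2 → ℂ) (a : CoxIndex → ℂ), z ≠ 0 ∧ w ≠ 0 ∧
      c = coxDeriv scrollMonomial (Sum.elim z w) a := by
  obtain ⟨q, l, rfl⟩ : ∃ q l, c = Sum.elim q l :=
    ⟨c ∘ Sum.inl, c ∘ Sum.inr, (Sum.elim_comp_inl_inr c).symm⟩
  obtain ⟨p, r, h, x, y, hq⟩ := exists_secant_or_tangent_cubic q
  obtain ⟨hp, hr⟩ := ne_zero_of_wedge_ne_zero h
  obtain ⟨a, b, rfl⟩ := exists_eq_smul_add_smul h l
  rcases hq with rfl | rfl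
  · refine Or.inl ⟨p, ![x, a], r, ![y, b], hp, hr, ?_⟩
    rw [coxValues_scrollMonomial, coxValues_scrollMonomial]
    funext k
    rcases k with k | k <;> simp
  · by_cases hw : ![y, b] = 0
    · refine Or.inl ⟨p, ![x, a], p, 0, hp, hp, ?_⟩
      have hy : y = 0 := congrFun hw 0
      have hb : b = 0 := congrFun hw 1
      rw [coxValues_scrollMonomial, coxValues_scrollMonomial, hy, hb]
      funext k
      rcases k with k | k <;> simp
    · refine Or.inr ⟨p, ![y, b], Sum.elim r ![x, a], hp, hw, ?_⟩
      rw [coxDeriv_scrollMonomial]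
      simp

lemma exists_scroll_linearEquiv (φ : HirzebruchEmbedding 2) (hφ : φ.IsQuarticScroll) :
    ∃ g : (Fin 4 ⊕ Fin 2 → ℂ) ≃ₗ[ℂ] (Fin 6 → ℂ), ∀ z w hz hw,
      HasCoords (φ.toFun (Hirzebruch.mk 2 (CoxPoint.of z w hz hw)))
        (g (Sum.elim (w 0 • cubicVector z) (w 1 • z))) := by
  obtain ⟨h1, h2⟩ := hφ
  have hcls : φ.cls = (1, 3) := by
    have h : φ.cls.1 = 1 := by simpa [interNumber] using h1
    ext
    · exact h
    · simp only [interNumber] at h2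
      rw [h] at h2
      push_cast at h2
      change φ.cls.2 = 3
      linarith
  have hmon : ∀ d : CoxIndex →₀ ℕ, Finsupp.weight (coxWeight 2) d = (1, 3) →
      ∃ k, scrollMonomial k = ∏ i, MvPolynomial.X i ^ d i := by
    intro d hd
    rw [weight_coxWeight, Prod.mk.injEq] at hd
    simp only [Fintype.prod_sum_type, Fin.prod_univ_two]
    obtain ⟨ha, hb⟩ := hd
    push_cast at hb
    have hcases : (d (Sum.inr 0) = 1 ∧ d (Sum.inr 1) = 0 ∧
        ((d (Sum.inl 0) = 3 ∧ d (Sum.inl 1) = 0) ∨ (d (Sum.inl 0) = 2 ∧ d (Sum.inl 1) = 1) ∨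
        (d (Sum.inl 0) = 1 ∧ d (Sum.inl 1) = 2) ∨ (d (Sum.inl 0) = 0 ∧ d (Sum.inl 1) = 3))) ∨
        (d (Sum.inr 0) = 0 ∧ d (Sum.inr 1) = 1 ∧
        ((d (Sum.inl 0) = 1 ∧ d (Sum.inl 1) = 0) ∨ (d (Sum.inl 0) = 0 ∧ d (Sum.inl 1) = 1))) := by
      omega
    rcases hcases with ⟨e1, e2, ⟨e3, e4⟩ | ⟨e3, e4⟩ | ⟨e3, e4⟩ | ⟨e3, e4⟩⟩ |
      ⟨e1, e2, ⟨e3, e4⟩ | ⟨e3, e4⟩⟩ <;> rw [e1, e2, e3, e4]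
    · exact ⟨Sum.inl 0, by simp [scrollMonomial]; ring⟩
    · exact ⟨Sum.inl 1, by simp [scrollMonomial]; ring⟩
    · exact ⟨Sum.inl 2, by simp [scrollMonomial]; ring⟩
    · exact ⟨Sum.inl 3, by simp [scrollMonomial]; ring⟩
    · exact ⟨Sum.inr 0, by simp [scrollMonomial]; ring⟩
    · exact ⟨Sum.inr 1, by simp [scrollMonomial]; ring⟩
  choose m hm using fun i => exists_eq_sum_smul hmon (hcls ▸ φ.homogeneous i)
  have hinj : Function.Injective (Matrix.of m).mulVecLin := by
    refine φ.mulVec_injective (m := Matrix.of m) hm ?_ ?_ ?_ exists_scroll_secant_or_tangent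
    · intro p q hpq
      obtain ⟨z, w, hz, hw, rfl⟩ := p.exists_of
      obtain ⟨z', w', hz', hw', rfl⟩ := q.exists_of
      obtain ⟨a, b, k1, k2, k3⟩ := hpq
      -- The twist of `u` by `a ^ 2` gives both blocks of monomials the same factor.
      refine ⟨a ^ 3 * b, ?_⟩
      change coxValues scrollMonomial (Sum.elim z' w') =
        (a ^ 3 * b : ℂ) • coxValues scrollMonomial (Sum.elim z w)
      simp only [CoxPoint.of, Sum.elim_inl, Sum.elim_inr] at k1 k2 k3
      rw [coxValues_scrollMonomial, coxValues_scrollMonomial]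
      funext k
      rcases k with k | k <;> fin_cases k <;> simp [cubicVector, k1, k2, k3] <;> ring
    · intro z
      rw [coxValues_scrollMonomial]
      funext k
      rcases k with k | k <;> simp
    · intro p
      obtain ⟨z, w, hz, hw, rfl⟩ := p.exists_of
      -- Weights cancelling degree 3 in `z` in the first block and degree 1 in the second.
      refine ⟨Sum.elim z ![-3 * w 0, -w 1], ?_, ?_⟩
      · intro h
        exact hz (funext fun i => congrFun h (Sum.inl i))
      · change coxDeriv scrollMonomial (Sum.elim z w) _ = 0
        rw [coxDeriv_scrollMonomial]
        funext k
        rcases k with k | k <;> fin_cases k <;> simp [cubicVector, cubicDeriv] <;> ring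
  refine ⟨(Matrix.of m).mulVecLin.linearEquivOfInjective hinj (by simp), fun z w hz hw => ?_⟩
  rw [LinearMap.linearEquivOfInjective_apply, Matrix.mulVecLin_apply, ← coxValues_scrollMonomial]
  exact φ.hasCoords_mulVec (m := Matrix.of m) hm (CoxPoint.of z w hz hw)

/-- A quartic scroll `𝔽 2` is the join of corresponding points of a line and a twisted cubic in
complementary subspaces. -/
lemma exists_scroll_coordinates (φ : HirzebruchEmbedding 2) (hφ : φ.IsQuarticScroll) :
    ∃ (A : (Fin 4 → ℂ) →ₗ[ℂ] (Fin 6 → ℂ)) (B : (Fin 2 → ℂ) →ₗ[ℂ] (Fin 6 → ℂ)),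
      Function.Injective A ∧ IsCompl (LinearMap.range B) (LinearMap.range A) ∧
      ∀ z w hz hw, HasCoords (φ.toFun (Hirzebruch.mk 2 (CoxPoint.of z w hz hw)))
        (w 0 • A (cubicVector z) + w 1 • B z) := by
  obtain ⟨g, hg⟩ := exists_scroll_linearEquiv φ hφ
  let e := g.symm.trans (LinearEquiv.sumArrowLequivProdArrow (Fin 4) (Fin 2) ℂ ℂ)
  have he : ∀ q l, g (Sum.elim q l) = e.symm (q, l) := fun q l => rfl
  let A : (Fin 4 → ℂ) →ₗ[ℂ] (Fin 6 → ℂ) := e.symm.toLinearMap ∘ₗ LinearMap.inl ℂ _ _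
  let B : (Fin 2 → ℂ) →ₗ[ℂ] (Fin 6 → ℂ) := e.symm.toLinearMap ∘ₗ LinearMap.inr ℂ _ _
  refine ⟨A, B, e.symm.injective.comp LinearMap.inl_injective, ?_, fun z w hz hw => ?_⟩
  · have h : IsCompl (LinearMap.range (LinearMap.inr ℂ (Fin 4 → ℂ) (Fin 2 → ℂ)))
        (LinearMap.range (LinearMap.inl ℂ (Fin 4 → ℂ) (Fin 2 → ℂ))) :=
      LinearMap.isCompl_range_inl_inr.symm
    rw [LinearMap.range_comp, LinearMap.range_comp]
    exact h.map (Submodule.orderIsoMapComap e.symm)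
  · have : w 0 • A (cubicVector z) + w 1 • B z =
        g (Sum.elim (w 0 • cubicVector z) (w 1 • z)) := by
      rw [he]
      simp only [A, B, LinearMap.comp_apply, LinearEquiv.coe_coe, ← map_smul, ← map_add]
      simp
    rw [this]
    exact hg z w hz hw

/-! ### Cones over twisted cubics -/

lemma HasCoords.mem_linearPoints_iff {p : P5} {v : Fin 6 → ℂ} (h : HasCoords p v)
    (W : Submodule ℂ (Fin 6 → ℂ)) : p ∈ linearPoints W ↔ v ∈ W := by
  rw [linearPoints, Set.mem_ofPred_eq, h.submodule_eq, Submodule.span_singleton_le_iff_mem]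

lemma linearPoints_injective : Function.Injective linearPoints := by
  intro W W' h
  ext v
  by_cases hv : v = 0
  · simp [hv]
  · rw [← (hasCoords_mk hv).mem_linearPoints_iff, h, (hasCoords_mk hv).mem_linearPoints_iff]

lemma cubicVector_ne_zero {y : Fin 2 → ℂ} (hy : y ≠ 0) : cubicVector y ≠ 0 := by
  intro h
  rcases fin_two_ne_zero hy with h0 | h0
  · exact h0 (by simpa [cubicVector] using congrFun h 0)
  · exact h0 (by simpa [cubicVector] using congrFun h 3)

lemma cubicVector_smul (c : ℂ) (y : Fin 2 → ℂ) : cubicVector (c • y) = c ^ 3 • cubicVector y := by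
  funext i
  fin_cases i <;> simp [cubicVector] <;> ring

lemma mem_rationalNormalCubic_iff {A : (Fin 4 → ℂ) →ₗ[ℂ] (Fin 6 → ℂ)} {p : P5} :
    p ∈ rationalNormalCubic A ↔ ∃ z, z ≠ 0 ∧ HasCoords p (A (cubicVector z)) := by
  constructor
  · rintro ⟨s, t, h, hc⟩
    refine ⟨![s, t], ?_, hc⟩
    intro h0
    have e0 : s = 0 := congrFun h0 0
    have e1 : t = 0 := congrFun h0 1
    simp [e0, e1] at h
  · rintro ⟨z, hz, hc⟩
    exact ⟨z 0, z 1, fin_two_ne_zero hz, hc⟩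

lemma HasCoords.mem_projectiveJoin_iff {W : Submodule ℂ (Fin 6 → ℂ)} (hW : W ≠ ⊥)
    {A : (Fin 4 → ℂ) →ₗ[ℂ] (Fin 6 → ℂ)} (hA : Function.Injective A) {p : P5} {v : Fin 6 → ℂ}
    (h : HasCoords p v) : p ∈ projectiveJoin (linearPoints W) (rationalNormalCubic A) ↔
      ∃ b ∈ W, ∃ (c : ℂ) (z : Fin 2 → ℂ), z ≠ 0 ∧ v = b + c • A (cubicVector z) := by
  constructor
  · rintro ⟨x, hx, y, hy, hle⟩
    obtain ⟨z, hz, hyc⟩ := mem_rationalNormalCubic_iff.1 hy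
    have hv : v ∈ x.submodule ⊔ y.submodule := by
      apply hle
      rw [h.submodule_eq]
      exact Submodule.mem_span_singleton_self v
    obtain ⟨b, hb, d, hd, rfl⟩ := Submodule.mem_sup.1 hv
    rw [hyc.submodule_eq] at hd
    obtain ⟨c, rfl⟩ := Submodule.mem_span_singleton.1 hd
    exact ⟨b, hx hb, c, z, hz, rfl⟩
  · rintro ⟨b, hb, c, z, hz, rfl⟩
    -- If `b = 0`, any point of the vertex can serve as an end of the joining line.
    obtain ⟨b', hb', hb0, hbb⟩ : ∃ b' ∈ W, b' ≠ 0 ∧ b ∈ Submodule.span ℂ {b'} := by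
      by_cases hb0 : b = 0
      · obtain ⟨b', hb', hb0'⟩ := (Submodule.ne_bot_iff _).1 hW
        exact ⟨b', hb', hb0', by simp [hb0]⟩
      · exact ⟨b, hb, hb0, Submodule.mem_span_singleton_self b⟩
    have hAz : A (cubicVector z) ≠ 0 := (map_ne_zero_iff A hA).2 (cubicVector_ne_zero hz)
    refine ⟨_, ((hasCoords_mk hb0).mem_linearPoints_iff W).2 hb', _,
      mem_rationalNormalCubic_iff.2 ⟨z, hz, hasCoords_mk hAz⟩, ?_⟩
    rw [h.submodule_eq, (hasCoords_mk hb0).submodule_eq, (hasCoords_mk hAz).submodule_eq,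
      Submodule.span_singleton_le_iff_mem]
    exact Submodule.add_mem_sup hbb
      (Submodule.smul_mem _ _ (Submodule.mem_span_singleton_self _))

/-- A plane meets the twisted cubic. -/
lemma exists_cubicVector_eq_zero (ψ : (Fin 4 → ℂ) →ₗ[ℂ] ℂ) :
    ∃ z, z ≠ 0 ∧ ψ (cubicVector z) = 0 := by
  have hψ : ∀ x, ψ x = x 0 * ψ (Pi.single 0 1) + x 1 * ψ (Pi.single 1 1) +
      x 2 * ψ (Pi.single 2 1) + x 3 * ψ (Pi.single 3 1) := by
    intro x
    rw [LinearMap.pi_apply_eq_sum_univ ψ x, Fin.sum_univ_four]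
    congr! 6 <;> simp [Pi.single_apply, eq_comm]
  by_cases h : ψ (Pi.single 0 1) = 0
  · exact ⟨![1, 0], by simp, by rw [hψ]; simp [cubicVector, h]⟩
  · let P : Cubic ℂ := ⟨ψ (Pi.single 0 1), ψ (Pi.single 1 1), ψ (Pi.single 2 1), ψ (Pi.single 3 1)⟩
    obtain ⟨s, hs⟩ := IsAlgClosed.exists_root P.toPoly
      (by rw [Cubic.degree_of_a_ne_zero h]; norm_num)
    refine ⟨![s, 1], by simp, ?_⟩
    rw [hψ]
    simp [P, Cubic.toPoly] at hs
    simp [cubicVector]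
    linear_combination hs

/-- The linear form of the osculating plane of the twisted cubic at the point with parameter `r`. -/
def osculatingForm (r : Fin 2 → ℂ) : (Fin 4 → ℂ) →ₗ[ℂ] ℂ where
  toFun a := r 0 ^ 3 * a 3 - 3 * r 0 ^ 2 * r 1 * a 2 + 3 * r 0 * r 1 ^ 2 * a 1 - r 1 ^ 3 * a 0
  map_add' a b := by simp; ring
  map_smul' c a := by simp; ring

/-- The osculating plane meets the curve only at its point of contact, with multiplicity three. -/
lemma osculatingForm_cubicVector (r z : Fin 2 → ℂ) :
    osculatingForm r (cubicVector z) = wedge r z ^ 3 := by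
  simp [osculatingForm, cubicVector, wedge]
  ring

/-- A linear map from the cone of one twisted cubic to the cone of another, modulo the vertex, is
surjective. -/
lemma exists_cubic_preimage {W : Submodule ℂ (Fin 6 → ℂ)}
    {A A' : (Fin 4 → ℂ) →ₗ[ℂ] (Fin 6 → ℂ)} (hA' : Function.Injective A')
    (hc : IsCompl W (LinearMap.range A'))
    (h : ∀ z, z ≠ 0 → ∃ b ∈ W, ∃ (c : ℂ) (y : Fin 2 → ℂ), y ≠ 0 ∧ c ≠ 0 ∧
      A (cubicVector z) = b + c • A' (cubicVector y))
    {y : Fin 2 → ℂ} (hy : y ≠ 0) : ∃ b ∈ W, ∃ (c : ℂ) (z : Fin 2 → ℂ), z ≠ 0 ∧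
      A' (cubicVector y) = b + c • A (cubicVector z) := by
  obtain ⟨π, hπW, hπA⟩ : ∃ π : (Fin 6 → ℂ) →ₗ[ℂ] (Fin 4 → ℂ), (∀ b ∈ W, π b = 0) ∧
      ∀ a, π (A' a) = a := by
    refine ⟨(LinearEquiv.ofInjective A' hA').symm.toLinearMap ∘ₗ
      Submodule.projectionOnto _ _ hc.symm, fun b hb => ?_, fun a => ?_⟩
    · simp [(Submodule.projectionOnto_apply_eq_zero_iff hc.symm).2 hb]
    · have := Submodule.projectionOnto_apply_left hc.symm (LinearEquiv.ofInjective A' hA' a)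
      rw [LinearEquiv.ofInjective_apply] at this
      simp [this]
  -- Pull the osculating plane at `y` back to the first cubic and take a zero `z`. The image of that
  -- point lies on the second cubic and on the plane, so it is the point `y`.
  obtain ⟨z, hz, hroot⟩ := exists_cubicVector_eq_zero (osculatingForm y ∘ₗ π ∘ₗ A)
  obtain ⟨b, hb, c, x, hx, hc0, e⟩ := h z hz
  have hw : wedge y x = 0 := by
    simp only [LinearMap.comp_apply] at hroot
    rw [e, map_add, hπW b hb, zero_add, map_smul, hπA, map_smul, osculatingForm_cubicVector]
      at hroot
    simpa [hc0] using hroot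
  obtain ⟨k, rfl⟩ := exists_smul_of_wedge_eq_zero hy hw
  have hk : c * k ^ 3 ≠ 0 := by
    refine mul_ne_zero hc0 (pow_ne_zero 3 ?_)
    rintro rfl
    simp at hx
  refine ⟨-(c * k ^ 3)⁻¹ • b, W.smul_mem _ hb, (c * k ^ 3)⁻¹, z, hz, ?_⟩
  rw [e, cubicVector_smul, map_smul, smul_smul, smul_add, smul_smul, inv_mul_cancel₀ hk, one_smul,
    neg_smul]
  abel

lemma projectiveJoin_subset {W : Submodule ℂ (Fin 6 → ℂ)} (hW : W ≠ ⊥)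
    {A A' : (Fin 4 → ℂ) →ₗ[ℂ] (Fin 6 → ℂ)} (hA : Function.Injective A)
    (hA' : Function.Injective A')
    (h : ∀ z, z ≠ 0 → ∃ b ∈ W, ∃ (c : ℂ) (y : Fin 2 → ℂ), y ≠ 0 ∧
      A (cubicVector z) = b + c • A' (cubicVector y)) :
    projectiveJoin (linearPoints W) (rationalNormalCubic A) ⊆
      projectiveJoin (linearPoints W) (rationalNormalCubic A') := by
  intro p hp
  obtain ⟨v, hv⟩ := exists_hasCoords p
  obtain ⟨b, hb, c, z, hz, rfl⟩ := (hv.mem_projectiveJoin_iff hW hA).1 hp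
  obtain ⟨b', hb', c', y, hy, e⟩ := h z hz
  refine (hv.mem_projectiveJoin_iff hW hA').2
    ⟨b + c • b', W.add_mem hb (W.smul_mem _ hb'), c * c', y, hy, ?_⟩
  rw [e, smul_add, smul_smul, add_assoc]

/-! ### Existence and uniqueness of the cone -/

/-- The cone over a twisted cubic with vertex the minimal section that contains a quartic scroll
`𝔽 2` exists and is unique. -/
theorem existsUnique_cone (φ : HirzebruchEmbedding 2) (hφ : φ.IsQuarticScroll) :
    ∃! T : Set P5, IsConeOverRationalNormalCubic (φ.toFun '' minimalSection 2) T ∧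
      φ.surface ⊆ T := by
  obtain ⟨A, B, hA, hAB, hφAB⟩ := exists_scroll_coordinates φ hφ
  have hE : φ.toFun '' minimalSection 2 = linearPoints (LinearMap.range B) := by
    ext p
    constructor
    · rintro ⟨_, ⟨q, hq, rfl⟩, rfl⟩
      obtain ⟨z, w, hz, hw, rfl⟩ := q.exists_of
      have hw0 : w 0 = 0 := hq
      rw [(hφAB z w hz hw).mem_linearPoints_iff, hw0, zero_smul, zero_add]
      exact Submodule.smul_mem _ _ ⟨z, rfl⟩
    · intro hp
      obtain ⟨v, hv⟩ := exists_hasCoords p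
      obtain ⟨z, rfl⟩ := (hv.mem_linearPoints_iff _).1 hp
      have hz : z ≠ 0 := by
        rintro rfl
        exact hv.ne_zero (map_zero B)
      have hw : (![0, 1] : Fin 2 → ℂ) ≠ 0 := by simp
      refine ⟨_, ⟨CoxPoint.of z ![0, 1] hz hw, rfl, rfl⟩, ?_⟩
      have := hφAB z ![0, 1] hz hw
      simp only [Matrix.cons_val_zero, Matrix.cons_val_one, zero_smul, zero_add, one_smul]
        at this
      exact this.eq hv
  have hW : LinearMap.range B ≠ ⊥ := by
    have hz : (![1, 0] : Fin 2 → ℂ) ≠ 0 := by simp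
    have h := hφAB ![1, 0] ![0, 1] hz (by simp)
    simp only [Matrix.cons_val_zero, Matrix.cons_val_one, zero_smul, zero_add, one_smul] at h
    exact (Submodule.ne_bot_iff _).2 ⟨_, ⟨_, rfl⟩, h.ne_zero⟩
  rw [hE]
  refine ⟨projectiveJoin (linearPoints (LinearMap.range B)) (rationalNormalCubic A),
    ⟨⟨_, A, rfl, hA, hAB, rfl⟩, ?_⟩, ?_⟩
  · rintro _ ⟨q, rfl⟩
    obtain ⟨p, rfl⟩ := Quotient.exists_rep q
    obtain ⟨z, w, hz, hw, rfl⟩ := p.exists_of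
    exact ((hφAB z w hz hw).mem_projectiveJoin_iff hW hA).2
      ⟨w 1 • B z, Submodule.smul_mem _ _ ⟨z, rfl⟩, w 0, z, hz, add_comm _ _⟩
  · rintro T ⟨⟨W, A', hWB, hA', hWA', rfl⟩, hsub⟩
    obtain rfl := linearPoints_injective hWB
    -- The points with fibre coordinates (1, 0) trace the cubic of `A` inside R, hence inside the
    -- second cone. They avoid the vertex, which gives `c ≠ 0`.
    have h : ∀ z, z ≠ 0 → ∃ b ∈ LinearMap.range B, ∃ (c : ℂ) (y : Fin 2 → ℂ), y ≠ 0 ∧ c ≠ 0 ∧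
        A (cubicVector z) = b + c • A' (cubicVector y) := by
      intro z hz
      have hc := hφAB z ![1, 0] hz (by simp)
      simp only [Matrix.cons_val_zero, Matrix.cons_val_one, zero_smul, add_zero, one_smul] at hc
      obtain ⟨b, hb, c, y, hy, e⟩ := (hc.mem_projectiveJoin_iff hW hA').1 (hsub ⟨_, rfl⟩)
      refine ⟨b, hb, c, y, hy, ?_, e⟩
      rintro rfl
      rw [zero_smul, add_zero] at e
      exact hc.ne_zero (Submodule.disjoint_def.1 hAB.disjoint _ (e ▸ hb) ⟨_, rfl⟩)
    refine Set.Subset.antisymm ?_ ?_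
    · exact projectiveJoin_subset hW hA' hA fun y hy => exists_cubic_preimage hA' hWA' h hy
    · refine projectiveJoin_subset hW hA hA' fun z hz => ?_
      obtain ⟨b, hb, c, y, hy, -, e⟩ := h z hz
      exact ⟨b, hb, c, y, hy, e⟩

theorem mainTheorem6 (n : ℕ) (φ : HirzebruchEmbedding n) (hφ : φ.IsQuarticScroll) :
    (n = 0 → ∃! S : Set P5, IsCubicSegreProductContaining 0 2 φ.surface S) ∧
    (n = 2 → ∃! T : Set P5,
      IsConeOverRationalNormalCubic (φ.toFun '' minimalSection n) T ∧ φ.surface ⊆ T) := by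
  constructor
  · rintro rfl
    exact existsUnique_cubicSegreProduct φ hφ
  · rintro rfl
    exact existsUnique_cone φ hφ
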